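/- All Hilbert spaces are complex, inner products are linear in the second variable, and $[S]$ denotes the norm-closed linear span of a set $S$. **$C^*$-bases and modules.** A $C^*$-base $\mathfrak b=(\mathfrak K,\mathfrak B,\mathfrak B^\dagger)$ consists of a Hilbert space $\mathfrak K$ and two commuting nondegenerate $C^*$-algebras $\mathfrak B,\mathfrak B^\dagger\subseteq\mathcal L(\mathfrak K)$; its opposite is $\mathfrak b^\dagger=(\mathfrak K,\mathfrak B^\dagger,\mathfrak B)$. A $C^*$-$\mathfrak b$-module $H_\alpha$ is a Hilbert space $H$ with a closed subspace $\alpha\subseteq\mathcal L(\mathfrak K,H)$ such that $[\alpha\mathfrak K]=H$, $[\alpha\mathfrak B]=\alpha$, $[\alpha^*\alpha]=\mathfrak B$; it carries the representation $\rho_\alpha\colon\mathfrak B^\dagger\to\mathcal L(H)$, $\rho_\alpha(c)\xi\zeta=\xi c\zeta$ $(\xi\in\alpha,\zeta\in\mathfrak K)$. A tuple $(H,\alpha_1,\dots,\alpha_n)$ is a $C^*$-$(\mathfrak b_1,\dots,\mathfrak b_n)$-module if each $H_{\alpha_i}$ is a $C^*$-$\mathfrak b_i$-module and $[\rho_{\alpha_i}(\mathfrak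 B_i^\dagger)\alpha_j]=\alpha_j$ for $i\ne j$. A morphism between such modules $(H,\alpha_i)_i$ and $(K,\gamma_i)_i$ is an operator $T\in\mathcal L(H,K)$ with $T\alpha_i\subseteq\gamma_i$ and $T^*\gamma_i\subseteq\alpha_i$ for all $i$. **Relative tensor product.** For a $C^*$-$\mathfrak b$-module $H_\beta$ and a $C^*$-$\mathfrak b^\dagger$-module $K_\gamma$, $H\,{}_\beta\!\otimes_\gamma K$ is the Hilbert space spanned by elements $\xi\otimes\zeta\otimes\eta$ $(\xi\in\beta,\zeta\in\mathfrak K,\eta\in\gamma)$ with $\langle\xi\otimes\zeta\otimes\eta|\xi'\otimes\zeta'\otimes\eta'\rangle=\langle\zeta|\xi^*\xi'\eta^*\eta'\zeta'\rangle$. Define operators $|\xi\rangle_1\colon K\to H\,{}_\beta\!\otimes_\gamma K$, $\eta\zeta\mapsto\xi\otimes\zeta\otimes\eta$, and $|\eta\rangle_2\colon H\to H\,{}_\beta\!\otimes_\gamma K$, $\xi\zeta\mapsto\xi\otimes\zeta\otimes\eta$; write $\langle\xi|_i=|\xi\rangle_i^*$, $|\beta\rangle_1=\{|\xi\rangle_1:\xi\in\beta\}$,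 and so on. For further module structures $\alpha$ on $H$ and $\delta$ on $K$ put $\alpha\triangleleft\gamma=[|\gamma\rangle_2\alpha]$ and $\beta\triangleright\delta=[|\beta\rangle_1\delta]$. $\Sigma$ denotes the flip $\xi\otimes\zeta\otimes\eta\mapsto\eta\otimes\zeta\otimes\xi$. Unitaries $S$ with $S\beta=\beta'$ and $T$ with $T\gamma=\gamma'$ induce $S\otimes 1$ and $1\otimes T$ by $\xi\otimes\zeta\otimes\eta\mapsto S\xi\otimes\zeta\otimes\eta$ and $\xi\otimes\zeta\otimes\eta\mapsto\xi\otimes\zeta\otimes T\eta$. Iterated relative tensor products are identified via the canonical associativity isomorphism $(H\,{}_\beta\!\otimes_\gamma K)\,{}_{\beta\triangleright\epsilon}\!\otimes_\phi L\cong H\,{}_\beta\!\otimes_{\gamma\triangleleft\phi}(K\,{}_\epsilon\!\otimes_\phi L)$, $|\eta\rangle_2|\xi\rangle_1k\mapsto|\xi\rangle_1|\eta\rangle_2k$ $(\xi\in\beta,k\in K,\eta\in\phi)$. **$C^*$-pseudo-multiplicative unitaries.** Such a unitary over $\mathfrak b$ consists of a $C^*$-$(\mathfrak b^\dagger,\mathfrak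 b,\mathfrak b^\dagger)$-module $(H,\widehat\beta,\alpha,\beta)$ and a unitary $V\colon H\,{}_{\widehat\beta}\!\otimes_\alpha H\to H\,{}_\alpha\!\otimes_\beta H$ with $$V(\alpha\triangleleft\alpha)=\alpha\triangleright\alpha,\quad V(\widehat\beta\triangleright\beta)=\widehat\beta\triangleleft\beta,\quad V(\widehat\beta\triangleright\widehat\beta)=\alpha\triangleright\widehat\beta,\quad V(\beta\triangleleft\alpha)=\beta\triangleleft\beta$$ and $V_{12}V_{13}V_{23}=V_{23}V_{12}$ on $H\,{}_{\widehat\beta}\!\otimes_\alpha H\,{}_{\widehat\beta}\!\otimes_\alpha H$ (leg notation: $V_{ij}$ acts like $V$ on the $i$th and $j$th factor). Its legs are $$A=A_V=[\langle\alpha|_1V|\widehat\beta\rangle_1]\subseteq\mathcal L(H),\qquad\widehat A=\widehat A_V=[\langle\beta|_2V|\alpha\rangle_2]\subseteq\mathcal L(H),$$ and $V$ is regular if $[\langle\alpha|_1V|\alpha\rangle_2]=[\alpha\alpha^*]$. **$C^*$-pseudo-Kac systems.** Let $\mathfrak b$ be a $C^*$-base and $(H,\widehat\alpha,\widehat\beta,\alpha,\beta)$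 a $C^*$-$(\mathfrak b,\mathfrak b^\dagger,\mathfrak b,\mathfrak b^\dagger)$-module. Let $U\in\mathcal L(H)$ be a symmetry, $U=U^*=U^{-1}$, that is a morphism from $(H,\widehat\alpha,\widehat\beta)$ to $(H,\alpha,\beta)$, and let $V\colon H\,{}_{\widehat\beta}\!\otimes_\alpha H\to H\,{}_\alpha\!\otimes_\beta H$ be a $C^*$-pseudo-multiplicative unitary over $\mathfrak b$. Put $$\check V=\Sigma(1\otimes U)V(1\otimes U)\Sigma\colon H\,{}_{\widehat\alpha}\!\otimes_{\widehat\beta}H\to H\,{}_{\widehat\beta}\!\otimes_{\alpha}H,\qquad\widehat V=\Sigma(U\otimes1)V(U\otimes1)\Sigma\colon H\,{}_{\alpha}\!\otimes_{\beta}H\to H\,{}_{\beta}\!\otimes_{\widehat\alpha}H.$$ $(V,U)$ is a $C^*$-pseudo-Kac system if $\check V$ and $\widehat V$ are $C^*$-pseudo-multiplicative unitaries over $\mathfrak b^\dagger$ (on $(H,\widehat\alpha,\widehat\beta,\alpha)$ and $(H,\alpha,\beta,\widehat\alpha)$, respectively), $V,\check V,\widehat V$ are regular, and $(\Sigma(1\otimes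 U)V)^3=\mathrm{id}$ on $H\,{}_{\widehat\beta}\!\otimes_\alpha H$. **Proposition.** Let $(V,U)$ be a $C^*$-pseudo-Kac system on $(H,\widehat\alpha,\widehat\beta,\alpha,\beta)$. Then $$[A\widehat A]=[\widehat\alpha\,\widehat\alpha^*]\subseteq\mathcal L(H).$$ -/

import Mathlib

open scoped InnerProduct InnerProductSpace ComplexConjugate

noncomputable section

namespace PseudoKac

/-! ### Closed linear spans -/

/-- The closed linear span `[S]`. -/
def cspan {E : Type*} [NormedAddCommGroup E] [NormedSpace ℂ E] (S : Set E) : Submodule ℂ E :=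
  (Submodule.span ℂ S).topologicalClosure

section Cspan

variable {E F : Type*} [NormedAddCommGroup E] [NormedSpace ℂ E]
  [NormedAddCommGroup F] [NormedSpace ℂ F]

theorem subset_cspan (S : Set E) : S ⊆ cspan S := fun _ hx =>
  Submodule.le_topologicalClosure _ (Submodule.subset_span hx)

theorem isClosed_cspan (S : Set E) : IsClosed (cspan S : Set E) :=
  Submodule.isClosed_topologicalClosure _

theorem cspan_le {S : Set E} {C : Submodule ℂ E} (hC : IsClosed (C : Set E)) (h : S ⊆ C) :
    cspan S ≤ C :=
  Submodule.topologicalClosure_minimal _ (Submodule.span_le.2 h) hC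

theorem cspan_map_mem (f : E →L[ℂ] F) {S : Set E} {C : Submodule ℂ F}
    (hC : IsClosed (C : Set F)) (h : ∀ a ∈ S, f a ∈ C) : ∀ a ∈ cspan S, f a ∈ C := by
  have h1 : IsClosed ((C.comap (f : E →ₗ[ℂ] F) : Submodule ℂ E) : Set E) :=
    hC.preimage f.continuous
  exact fun a ha => cspan_le (C := C.comap (f : E →ₗ[ℂ] F)) h1 (fun a ha => h a ha) ha

theorem cspan_eq_top_of_forall {S T : Set E} (hS : cspan S = ⊤) (h : ∀ a ∈ S, a ∈ cspan T) :
    cspan T = ⊤ :=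
  top_le_iff.1 (hS ▸ cspan_le (isClosed_cspan T) h)

theorem denseRange_linearCombination {ι : Type*} {x : ι → E} (hx : cspan (Set.range x) = ⊤) :
    DenseRange (Finsupp.linearCombination ℂ x) := by
  rw [DenseRange, ← LinearMap.coe_range, Finsupp.range_linearCombination]
  exact Submodule.dense_iff_topologicalClosure_eq_top.2 hx

theorem ext_of_cspan_eq_top {ι : Type*} {x : ι → E} (hx : cspan (Set.range x) = ⊤)
    {S T : E →L[ℂ] F} (h : ∀ i, S (x i) = T (x i)) : S = T := by
  apply ContinuousLinearMap.ext_on (s := Set.range x)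
  · exact Submodule.dense_iff_topologicalClosure_eq_top.2 hx
  · rintro _ ⟨i, rfl⟩
    exact h i

end Cspan

/-! ### Hilbert spaces and operators determined by Gram kernels -/

/-- Positivity of the quadratic form of a kernel. -/
def KerNonneg {ι : Type*} (k : ι → ι → ℂ) : Prop :=
  ∀ f : ι →₀ ℂ, 0 ≤ (f.sum fun i a => f.sum fun j b => conj a * b * k i j).re

/-- Positive semidefinite kernels. -/
structure IsPSD {ι : Type*} (k : ι → ι → ℂ) : Prop where
  conj_symm : ∀ i j, conj (k i j) = k j i
  nonneg : KerNonneg k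

section Gram

variable {ι : Type*} {k : ι → ι → ℂ}

/-- The sesquilinear form `⟨i | j⟩ = k i j` on the linear span of the symbols `i : ι`. -/
@[reducible]
def preGramCore (h : IsPSD k) : PreInnerProductSpace.Core ℂ (ι →₀ ℂ) where
  inner f g := f.sum fun i a => g.sum fun j b => conj a * b * k i j
  conj_inner_symm f g := by
    rw [Finsupp.sum_comm]
    simp only [map_finsuppSum, map_mul, Complex.conj_conj, h.conj_symm]
    simp only [mul_comm]
  re_inner_nonneg f := h.nonneg f
  add_left f g l := by
    rw [Finsupp.sum_add_index'] <;> simp [← Finsupp.sum_add, add_mul]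
  smul_left f g r := by
    rw [Finsupp.sum_smul_index] <;> simp [Finsupp.mul_sum, mul_assoc]

/-- The linear span of the symbols `i : ι`, as a space with the form determined by `k`. -/
@[nolint unusedArguments]
def PreGram (_h : IsPSD k) : Type _ := ι →₀ ℂ

instance PreGram.instAddCommGroup (h : IsPSD k) : AddCommGroup (PreGram h) :=
  inferInstanceAs (AddCommGroup (ι →₀ ℂ))

instance PreGram.instModule (h : IsPSD k) : Module ℂ (PreGram h) :=
  inferInstanceAs (Module ℂ (ι →₀ ℂ))

instance PreGram.instCore (h : IsPSD k) : PreInnerProductSpace.Core ℂ (PreGram h) :=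
  preGramCore h

instance PreGram.instSeminormedAddCommGroup (h : IsPSD k) : SeminormedAddCommGroup (PreGram h) :=
  InnerProductSpace.Core.toSeminormedAddCommGroup (𝕜 := ℂ)

instance PreGram.instInnerProductSpace (h : IsPSD k) : InnerProductSpace ℂ (PreGram h) :=
  .ofCore _

/-- The Hilbert space obtained from the form `k` by separated completion. -/
def GramSpace (h : IsPSD k) : Type _ := UniformSpace.Completion (PreGram h)

instance (h : IsPSD k) : NormedAddCommGroup (GramSpace h) :=
  inferInstanceAs (NormedAddCommGroup (UniformSpace.Completion (PreGram h)))
instance (h : IsPSD k) : InnerProductSpace ℂ (GramSpace h) :=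
  inferInstanceAs (InnerProductSpace ℂ (UniformSpace.Completion (PreGram h)))
instance (h : IsPSD k) : CompleteSpace (GramSpace h) :=
  inferInstanceAs (CompleteSpace (UniformSpace.Completion (PreGram h)))

/-- The generating vector with index `i`. -/
def GramSpace.gen (h : IsPSD k) (i : ι) : GramSpace h :=
  ((show PreGram h from Finsupp.single i (1 : ℂ)) : UniformSpace.Completion (PreGram h))

theorem GramSpace.inner_gen (h : IsPSD k) (i j : ι) :
    ⟪GramSpace.gen h i, GramSpace.gen h j⟫_ℂ = k i j := by
  refine (UniformSpace.Completion.inner_coe (𝕜 := ℂ) (E := PreGram h) _ _).trans ?_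
  change Finsupp.sum (Finsupp.single i (1 : ℂ)) (fun i a =>
    Finsupp.sum (Finsupp.single j (1 : ℂ)) fun j b => conj a * b * k i j) = _
  simp

theorem GramSpace.cspan_gen (h : IsPSD k) : cspan (Set.range (GramSpace.gen h)) = ⊤ := by
  let c : PreGram h →ₗ[ℂ] GramSpace h :=
    (UniformSpace.Completion.toComplL (𝕜 := ℂ) (E := PreGram h)).toLinearMap
  have key : ∀ f : ι →₀ ℂ, c f ∈ Submodule.span ℂ (Set.range (GramSpace.gen h)) := by
    intro f
    induction f using Finsupp.induction_linear with
    | zero => exact (map_zero c).symm ▸ Submodule.zero_mem _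
    | add f g hf hg => exact (map_add c (f : PreGram h) g).symm ▸ Submodule.add_mem _ hf hg
    | single i a =>
      have h1 : (Finsupp.single i a : ι →₀ ℂ) = a • Finsupp.single i 1 := by simp
      rw [h1]
      exact (map_smul c a (Finsupp.single i (1 : ℂ) : ι →₀ ℂ)).symm ▸
        Submodule.smul_mem _ _ (Submodule.subset_span ⟨i, rfl⟩)
  refine Submodule.dense_iff_topologicalClosure_eq_top.1 ?_
  refine Dense.mono ?_ (UniformSpace.Completion.denseRange_coe (α := PreGram h))
  rintro _ ⟨f, rfl⟩
  exact key f

variable {E F : Type*} [NormedAddCommGroup E] [InnerProductSpace ℂ E]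
  [NormedAddCommGroup F] [InnerProductSpace ℂ F]

theorem inner_linearCombination (x : ι → E) (f : ι →₀ ℂ) :
    ⟪Finsupp.linearCombination ℂ x f, Finsupp.linearCombination ℂ x f⟫_ℂ =
      f.sum fun i a => f.sum fun j b => conj a * b * ⟪x i, x j⟫_ℂ := by
  simp only [Finsupp.linearCombination_apply, Finsupp.sum_inner, Finsupp.inner_sum,
    inner_smul_left, inner_smul_right]
  simp only [Finsupp.sum, Finset.mul_sum]
  rw [Finset.sum_comm]
  refine Finset.sum_congr rfl fun i _ => Finset.sum_congr rfl fun j _ => ?_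
  ring

theorem norm_bound_of_kerNonneg (x : ι → E) (y : ι → F) {C : ℝ} (hC : 0 ≤ C)
    (h : KerNonneg fun i j => (C : ℂ) ^ 2 * ⟪x i, x j⟫_ℂ - ⟪y i, y j⟫_ℂ) (f : ι →₀ ℂ) :
    ‖Finsupp.linearCombination ℂ y f‖ ≤ C * ‖Finsupp.linearCombination ℂ x f‖ := by
  have h1 := h f
  have h2 : (f.sum fun i a => f.sum fun j b => conj a * b *
      ((C : ℂ) ^ 2 * ⟪x i, x j⟫_ℂ - ⟪y i, y j⟫_ℂ)) =
      ((C ^ 2 : ℝ) : ℂ) * ⟪Finsupp.linearCombination ℂ x f, Finsupp.linearCombination ℂ x f⟫_ℂ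
        - ⟪Finsupp.linearCombination ℂ y f, Finsupp.linearCombination ℂ y f⟫_ℂ := by
    rw [inner_linearCombination, inner_linearCombination]
    simp only [Finsupp.sum, Finset.mul_sum, ← Finset.sum_sub_distrib]
    refine Finset.sum_congr rfl fun i _ => Finset.sum_congr rfl fun j _ => ?_
    push_cast
    ring
  rw [h2, Complex.sub_re, Complex.re_ofReal_mul, sub_nonneg] at h1
  have h4 := inner_self_eq_norm_sq (𝕜 := ℂ) (Finsupp.linearCombination ℂ x f)
  have h5 := inner_self_eq_norm_sq (𝕜 := ℂ) (Finsupp.linearCombination ℂ y f)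
  simp only [RCLike.re_to_complex] at h4 h5
  rw [h4, h5, ← mul_pow] at h1
  exact (sq_le_sq₀ (norm_nonneg _) (by positivity)).1 h1

theorem norm_linearCombination_eq {x : ι → E} {y : ι → F}
    (h : ∀ i j, ⟪x i, x j⟫_ℂ = ⟪y i, y j⟫_ℂ) (f : ι →₀ ℂ) :
    ‖Finsupp.linearCombination ℂ y f‖ = ‖Finsupp.linearCombination ℂ x f‖ := by
  have h1 := inner_linearCombination x f
  have h2 := inner_linearCombination y f
  simp only [h] at h1
  rw [← h2] at h1
  have h4 := inner_self_eq_norm_sq (𝕜 := ℂ) (Finsupp.linearCombination ℂ x f)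
  have h5 := inner_self_eq_norm_sq (𝕜 := ℂ) (Finsupp.linearCombination ℂ y f)
  rw [h1, h5] at h4
  exact (sq_eq_sq₀ (norm_nonneg _) (norm_nonneg _)).1 h4

variable [CompleteSpace F]

/-- The bounded operator determined by `x i ↦ y i` (for a family `x` with dense span). -/
def gramMap (x : ι → E) (y : ι → F) : E →L[ℂ] F :=
  (Finsupp.linearCombination ℂ y).extendOfNorm (Finsupp.linearCombination ℂ x)

theorem gramMap_apply {x : ι → E} {y : ι → F} (hx : cspan (Set.range x) = ⊤)
    {C : ℝ} (hC : 0 ≤ C)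
    (h : KerNonneg fun i j => (C : ℂ) ^ 2 * ⟪x i, x j⟫_ℂ - ⟪y i, y j⟫_ℂ) (i : ι) :
    gramMap x y (x i) = y i := by
  have := LinearMap.extendOfNorm_eq (f := Finsupp.linearCombination ℂ y)
    (e := Finsupp.linearCombination ℂ x) (denseRange_linearCombination hx)
    ⟨C, norm_bound_of_kerNonneg x y hC h⟩ (Finsupp.single i 1)
  simpa [gramMap] using this

theorem norm_gramMap_le {x : ι → E} {y : ι → F} (hx : cspan (Set.range x) = ⊤)
    {C : ℝ} (hC : 0 ≤ C)
    (h : KerNonneg fun i j => (C : ℂ) ^ 2 * ⟪x i, x j⟫_ℂ - ⟪y i, y j⟫_ℂ) :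
    ‖gramMap x y‖ ≤ C :=
  LinearMap.opNorm_extendOfNorm_le (denseRange_linearCombination hx) hC
    (norm_bound_of_kerNonneg x y hC h)

variable [CompleteSpace E]

/-- The unitary determined by `x i ↦ y i`, for two families with dense spans and equal Gram
kernels. -/
def gramEquiv (x : ι → E) (y : ι → F) (hx : cspan (Set.range x) = ⊤)
    (hy : cspan (Set.range y) = ⊤) (h : ∀ i j, ⟪x i, x j⟫_ℂ = ⟪y i, y j⟫_ℂ) : E ≃ₗᵢ[ℂ] F :=
  LinearEquiv.extendOfIsometry (LinearEquiv.refl ℂ (ι →₀ ℂ)) (Finsupp.linearCombination ℂ x)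
    (Finsupp.linearCombination ℂ y) (denseRange_linearCombination hx)
    (denseRange_linearCombination hy) (norm_linearCombination_eq h)

theorem gramEquiv_apply {x : ι → E} {y : ι → F} (hx : cspan (Set.range x) = ⊤)
    (hy : cspan (Set.range y) = ⊤) (h : ∀ i j, ⟪x i, x j⟫_ℂ = ⟪y i, y j⟫_ℂ) (i : ι) :
    gramEquiv x y hx hy h (x i) = y i := by
  have := LinearEquiv.extendOfIsometry_eq (f := LinearEquiv.refl ℂ (ι →₀ ℂ))
    (e₁ := Finsupp.linearCombination ℂ x) (e₂ := Finsupp.linearCombination ℂ y)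
    (denseRange_linearCombination hx)
    (denseRange_linearCombination hy) (norm_linearCombination_eq h) (Finsupp.single i 1)
  simpa [gramEquiv] using this

end Gram

/-! ### Positivity of Schur products of commuting operator matrices -/

section Schur

variable {𝔎 X Y : Type*} [NormedAddCommGroup 𝔎] [InnerProductSpace ℂ 𝔎] [CompleteSpace 𝔎]
  [NormedAddCommGroup X] [InnerProductSpace ℂ X] [CompleteSpace X]
  [NormedAddCommGroup Y] [InnerProductSpace ℂ Y] [CompleteSpace Y]

theorem exists_sqrt {P : X →L[ℂ] X} (hP : 0 ≤ P) :
    ∃ R : X →L[ℂ] X, (R)† = R ∧ R * R = P ∧ ∀ T, Commute P T → Commute R T :=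
  ⟨CFC.sqrt P, (IsSelfAdjoint.of_nonneg (CFC.sqrt_nonneg P)).star_eq, CFC.sqrt_mul_sqrt_self P hP,
    fun _ hT => hT.cfcₙ_nnreal _⟩

theorem schur_fintype {ι : Type*} [Fintype ι] (x : ι → 𝔎 →L[ℂ] X) (y : ι → 𝔎 →L[ℂ] Y)
    (hc : ∀ i j k l, Commute ((x i)† ∘L x j) ((y k)† ∘L y l)) (ζ : ι → 𝔎) :
    0 ≤ (∑ i, ∑ j, ⟪ζ i, ((x i)† ∘L x j) (((y i)† ∘L y j) (ζ j))⟫_ℂ).re := by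
  classical
  let p : ι → PiLp 2 (fun _ : ι => 𝔎) →L[ℂ] 𝔎 := fun i => PiLp.proj 2 (fun _ : ι => 𝔎) i
  have hpp : ∀ (i j : ι) (v : 𝔎), p i (((p j)†) v) = if i = j then v else 0 := by
    intro i j v
    refine ext_inner_left ℂ fun w => ?_
    have h1 : ⟪w, p i (((p j)†) v)⟫_ℂ = ⟪p j (((p i)†) w), v⟫_ℂ := by
      rw [← ContinuousLinearMap.adjoint_inner_left, ContinuousLinearMap.adjoint_inner_right]
    have h2 : ((p j)†) v = WithLp.toLp 2 (Pi.single j v) := by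
      refine ext_inner_left ℂ fun u => ?_
      rw [ContinuousLinearMap.adjoint_inner_right, PiLp.inner_apply,
        Finset.sum_eq_single j]
      · simp [p]
      · intro b _ hb
        simp [Pi.single_eq_of_ne hb]
      · simp
    rw [h2]
    simp only [p, PiLp.proj_apply, Pi.single_apply]
  have hpext : ∀ u v : PiLp 2 (fun _ : ι => 𝔎), (∀ k, p k u = p k v) → u = v := by
    intro u v h
    ext k
    exact h k
  have hin : ∀ u v : PiLp 2 (fun _ : ι => 𝔎), ⟪u, v⟫_ℂ = ∑ k, ⟪p k u, p k v⟫_ℂ :=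
    fun u v => PiLp.inner_apply u v
  clear_value p
  let G : PiLp 2 (fun _ : ι => 𝔎) →L[ℂ] X := ∑ i, x i ∘L p i
  have hG : ∀ i v, G (((p i)†) v) = x i v := by
    intro i v
    simp only [G, sum_apply, ContinuousLinearMap.comp_apply, hpp, apply_ite, map_zero]
    simp
  let P := (G)† ∘L G
  have hP : 0 ≤ P := by
    rw [ContinuousLinearMap.nonneg_iff_isPositive]
    exact ContinuousLinearMap.isPositive_adjoint_comp_self G
  obtain ⟨R, hRs, hRR, hRc⟩ := exists_sqrt hP
  let r : ι → 𝔎 →L[ℂ] PiLp 2 (fun _ : ι => 𝔎) := fun i => R ∘L (p i)†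
  have hr : ∀ i j v w, ⟪r i v, r j w⟫_ℂ = ⟪v, ((x i)† ∘L x j) w⟫_ℂ := by
    intro i j v w
    calc ⟪r i v, r j w⟫_ℂ = ⟪((p i)†) v, ((R)† ∘L R) (((p j)†) w)⟫_ℂ := by
          simp [r, ContinuousLinearMap.adjoint_inner_right]
      _ = ⟪((p i)†) v, P (((p j)†) w)⟫_ℂ := by rw [hRs, ← hRR]; rfl
      _ = ⟪G (((p i)†) v), G (((p j)†) w)⟫_ℂ := by
          simp only [P, ContinuousLinearMap.comp_apply, ContinuousLinearMap.adjoint_inner_right]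
      _ = _ := by simp [hG, ContinuousLinearMap.adjoint_inner_right]
  let D : (𝔎 →L[ℂ] 𝔎) → PiLp 2 (fun _ : ι => 𝔎) →L[ℂ] PiLp 2 (fun _ : ι => 𝔎) :=
    fun t => ∑ k, (p k)† ∘L t ∘L p k
  have hD : ∀ t v k, p k (D t v) = t (p k v) := by
    intro t v k
    simp [D, hpp]
  have hDp : ∀ t k v, D t (((p k)†) v) = ((p k)†) (t v) := by
    intro t k v
    refine hpext _ _ fun l => ?_
    rw [hD, hpp, hpp]
    split_ifs <;> simp
  have hsum : ∀ u : PiLp 2 (fun _ : ι => 𝔎), u = ∑ k, ((p k)†) (p k u) := by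
    intro u
    refine hpext _ _ fun l => ?_
    simp [hpp]
  have hPp : ∀ k l v, p k (P (((p l)†) v)) = ((x k)† ∘L x l) v := by
    intro k l v
    refine ext_inner_left ℂ fun w => ?_
    rw [← ContinuousLinearMap.adjoint_inner_left]
    simp only [P, ContinuousLinearMap.comp_apply, ContinuousLinearMap.adjoint_inner_right, hG]
  have hDP : ∀ k l, Commute P (D ((y k)† ∘L y l)) := by
    intro k l
    have h1 : ∀ i v, (P * D ((y k)† ∘L y l)) (((p i)†) v) =
        (D ((y k)† ∘L y l) * P) (((p i)†) v) := by
      intro i v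
      refine hpext _ _ fun m => ?_
      simp only [mul_apply_eq_comp, hDp, hD, hPp]
      exact congrArg (fun T : 𝔎 →L[ℂ] 𝔎 => T v) (hc m i k l).eq
    refine ContinuousLinearMap.ext fun u => ?_
    rw [hsum u, map_sum, map_sum]
    exact Finset.sum_congr rfl fun i _ => h1 i _
  have hDR : ∀ k l, Commute R (D ((y k)† ∘L y l)) := fun k l => hRc _ (hDP k l)
  have hrD : ∀ k l j v, r j (((y k)† ∘L y l) v) = D ((y k)† ∘L y l) (r j v) := by
    intro k l j v
    have := congrArg (fun T : PiLp 2 (fun _ : ι => 𝔎) →L[ℂ] _ => T (((p j)†) v)) (hDR k l).eq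
    simp only [mul_apply_eq_comp, hDp] at this
    exact this
  have hmain : (∑ i, ∑ j, ⟪ζ i, ((x i)† ∘L x j) (((y i)† ∘L y j) (ζ j))⟫_ℂ) =
      ∑ k, ⟪∑ i, y i (p k (r i (ζ i))), ∑ j, y j (p k (r j (ζ j)))⟫_ℂ := by
    have h1 : ∀ i j, ⟪ζ i, ((x i)† ∘L x j) (((y i)† ∘L y j) (ζ j))⟫_ℂ =
        ∑ k, ⟪y i (p k (r i (ζ i))), y j (p k (r j (ζ j)))⟫_ℂ := by
      intro i j
      rw [← hr, hrD, hin]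
      refine Finset.sum_congr rfl fun k _ => ?_
      rw [hD]
      exact ContinuousLinearMap.adjoint_inner_right (y i) _ _
    simp only [h1, sum_inner, inner_sum]
    rw [Finset.sum_congr rfl fun i _ => Finset.sum_comm, Finset.sum_comm]
    exact Finset.sum_congr rfl fun k _ => Finset.sum_comm
  rw [hmain, Complex.re_sum]
  exact Finset.sum_nonneg fun k _ => inner_self_nonneg (𝕜 := ℂ)

theorem kerNonneg_schur {ι : Type*} (x : ι → 𝔎 →L[ℂ] X) (y : ι → 𝔎 →L[ℂ] Y)
    (hc : ∀ i j k l, Commute ((x i)† ∘L x j) ((y k)† ∘L y l)) (ζ : ι → 𝔎) :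
    KerNonneg fun i j => ⟪ζ i, ((x i)† ∘L x j) (((y i)† ∘L y j) (ζ j))⟫_ℂ := by
  intro f
  have h := schur_fintype (fun i : f.support => x i) (fun i : f.support => y i)
    (fun i j k l => hc i j k l) (fun i => f i • ζ i)
  rw [Finset.sum_coe_sort f.support (fun i => ∑ j : f.support,
    ⟪f i • ζ i, ((x i)† ∘L x j) (((y i)† ∘L y j) (f j • ζ j))⟫_ℂ)] at h
  refine h.trans_eq (congrArg Complex.re (Finset.sum_congr rfl fun i _ => ?_))
  rw [Finset.sum_coe_sort f.support (fun j =>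
    ⟪f i • ζ i, ((x i)† ∘L x j) (((y i)† ∘L y j) (f j • ζ j))⟫_ℂ)]
  refine Finset.sum_congr rfl fun j _ => ?_
  rw [map_smul, map_smul, inner_smul_left, inner_smul_right, ← mul_assoc]

/-- The defect operator of a bounded operator `T`. -/
theorem exists_defect (T : X →L[ℂ] Y) :
    ∃ D : X →L[ℂ] X, (D)† ∘L D = ((‖T‖ : ℂ) ^ 2) • ContinuousLinearMap.id ℂ X - (T)† ∘L T := by
  have hpos : 0 ≤ ((‖T‖ : ℂ) ^ 2) • ContinuousLinearMap.id ℂ X - (T)† ∘L T := by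
    rw [ContinuousLinearMap.nonneg_iff_isPositive, ContinuousLinearMap.isPositive_def']
    refine ⟨?_, fun v => ?_⟩
    · refine IsSelfAdjoint.sub (IsSelfAdjoint.smul ?_ (IsSelfAdjoint.one _)) ?_
      · simp [IsSelfAdjoint, ← Complex.ofReal_pow]
      · exact (ContinuousLinearMap.isPositive_adjoint_comp_self T).isSelfAdjoint
    · have h1 : ‖T v‖ ^ 2 ≤ ‖T‖ ^ 2 * ‖v‖ ^ 2 := by
        rw [← mul_pow]
        exact pow_le_pow_left₀ (norm_nonneg _) (T.le_opNorm v) 2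
      have h2 := inner_self_eq_norm_sq (𝕜 := ℂ) v
      have h3 := inner_self_eq_norm_sq (𝕜 := ℂ) (T v)
      simp only [RCLike.re_to_complex] at h2 h3
      rw [ContinuousLinearMap.reApplyInnerSelf_apply]
      simp only [sub_apply, smul_apply, ContinuousLinearMap.comp_apply, inner_sub_left,
        ContinuousLinearMap.adjoint_inner_left, inner_smul_left, ContinuousLinearMap.id_apply,
        RCLike.re_to_complex, Complex.sub_re]
      rw [← Complex.ofReal_pow, Complex.conj_ofReal, Complex.re_ofReal_mul, h2, h3]
      linarith
  obtain ⟨R, hRs, hRR, -⟩ := exists_sqrt hpos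
  exact ⟨R, hRs.symm ▸ hRR⟩

end Schur

/-! ### `C*`-bases and modules over them -/

section Modules

variable {𝔎 H K L : Type*} [NormedAddCommGroup 𝔎] [InnerProductSpace ℂ 𝔎] [CompleteSpace 𝔎]
  [NormedAddCommGroup H] [InnerProductSpace ℂ H] [CompleteSpace H]
  [NormedAddCommGroup K] [InnerProductSpace ℂ K] [CompleteSpace K]
  [NormedAddCommGroup L] [InnerProductSpace ℂ L] [CompleteSpace L]

/-- `(𝔎, B, Bd)` is a `C*`-base: `B` and `Bd` (for `𝔅` and `𝔅†`) are commuting nondegenerate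
`C*`-algebras of operators on the Hilbert space `𝔎`.  The opposite `C*`-base is `(𝔎, Bd, B)`. -/
structure IsCStarBase (B Bd : NonUnitalStarSubalgebra ℂ (𝔎 →L[ℂ] 𝔎)) : Prop where
  isClosed_left : IsClosed (B : Set (𝔎 →L[ℂ] 𝔎))
  isClosed_right : IsClosed (Bd : Set (𝔎 →L[ℂ] 𝔎))
  nondegenerate_left : cspan {ζ | ∃ b ∈ B, ∃ ζ', b ζ' = ζ} = ⊤
  nondegenerate_right : cspan {ζ | ∃ c ∈ Bd, ∃ ζ', c ζ' = ζ} = ⊤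
  commute : ∀ b ∈ B, ∀ c ∈ Bd, Commute b c

/-- A `C*`-`𝔟`-module `H_α`, for the `C*`-base `𝔟 = (𝔎, B, Bd)`: a closed subspace
`α ⊆ L(𝔎, H)` with `[α 𝔎] = H`, `[α B] = α` and `[α* α] = B`. -/
structure BaseModule (B Bd : NonUnitalStarSubalgebra ℂ (𝔎 →L[ℂ] 𝔎)) (H : Type*)
    [NormedAddCommGroup H] [InnerProductSpace ℂ H] [CompleteSpace H] where
  isBase : IsCStarBase B Bd
  space : Submodule ℂ (𝔎 →L[ℂ] H)
  isClosed : IsClosed (space : Set (𝔎 →L[ℂ] H))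
  span_apply : cspan {h | ∃ ξ ∈ space, ∃ ζ, ξ ζ = h} = ⊤
  span_right : cspan {x | ∃ ξ ∈ space, ∃ b ∈ B, ξ ∘L b = x} = space
  span_gram : (cspan {b | ∃ ξ ∈ space, ∃ ξ' ∈ space, (ξ)† ∘L ξ' = b} : Set (𝔎 →L[ℂ] 𝔎)) = B

variable {B Bd : NonUnitalStarSubalgebra ℂ (𝔎 →L[ℂ] 𝔎)}

namespace BaseModule

theorem gram_mem (α : BaseModule B Bd H) {ξ ξ' : 𝔎 →L[ℂ] H} (hξ : ξ ∈ α.space)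
    (hξ' : ξ' ∈ α.space) : (ξ)† ∘L ξ' ∈ B := by
  have : (ξ)† ∘L ξ' ∈ (B : Set (𝔎 →L[ℂ] 𝔎)) := by
    rw [← α.span_gram]
    exact subset_cspan _ ⟨ξ, hξ, ξ', hξ', rfl⟩
  exact this

/-- The vectors `ξ ζ`. -/
def vec (α : BaseModule B Bd H) (p : α.space × 𝔎) : H := (p.1 : 𝔎 →L[ℂ] H) p.2

theorem cspan_vec (α : BaseModule B Bd H) : cspan (Set.range α.vec) = ⊤ := by
  rw [← α.span_apply]
  congr 1
  ext h
  constructor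
  · rintro ⟨⟨⟨ξ, hξ⟩, ζ⟩, rfl⟩
    exact ⟨ξ, hξ, ζ, rfl⟩
  · rintro ⟨ξ, hξ, ζ, rfl⟩
    exact ⟨⟨⟨ξ, hξ⟩, ζ⟩, rfl⟩

theorem comp_mem (α : BaseModule B Bd H) {ξ : 𝔎 →L[ℂ] H} (hξ : ξ ∈ α.space)
    {b : 𝔎 →L[ℂ] 𝔎} (hb : b ∈ B) : ξ ∘L b ∈ α.space := by
  rw [← α.span_right]
  exact subset_cspan _ ⟨ξ, hξ, b, hb, rfl⟩

theorem rho_kernel (α : BaseModule B Bd H) (c : Bd) :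
    KerNonneg fun i j : α.space × 𝔎 => ((‖(c : 𝔎 →L[ℂ] 𝔎)‖ : ℝ) : ℂ) ^ 2 *
      ⟪α.vec i, α.vec j⟫_ℂ -
      ⟪(i.1 : 𝔎 →L[ℂ] H) ((c : 𝔎 →L[ℂ] 𝔎) i.2), (j.1 : 𝔎 →L[ℂ] H) ((c : 𝔎 →L[ℂ] 𝔎) j.2)⟫_ℂ := by
  obtain ⟨c, hc⟩ := c
  obtain ⟨D, hD⟩ := exists_defect c
  have hcc : (c)† ∘L c ∈ Bd := mul_mem (star_mem hc : star c ∈ Bd) hc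
  have h := kerNonneg_schur (ι := α.space × 𝔎) (fun _ => D) (fun i => (i.1 : 𝔎 →L[ℂ] H))
    (fun i j k l => by
      have hg := α.gram_mem k.1.2 l.1.2
      rw [hD]
      exact (((Commute.one_left _).smul_left _).sub_left (α.isBase.commute _ hg _ hcc).symm))
    (fun i => i.2)
  refine (congrArg KerNonneg ?_).mp h
  funext i j
  have hg := (α.isBase.commute _ (α.gram_mem i.1.2 j.1.2) _ (star_mem hc)).eq
  have hg' := congrArg (fun T : 𝔎 →L[ℂ] 𝔎 => T (c j.2)) hg
  have e1 : ((c)†) ((((i.1 : 𝔎 →L[ℂ] H))†) ((j.1 : 𝔎 →L[ℂ] H) (c j.2))) =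
      (((i.1 : 𝔎 →L[ℂ] H))†) ((j.1 : 𝔎 →L[ℂ] H) (((c)†) (c j.2))) := hg'.symm
  have hg2 := congrArg (fun T : 𝔎 →L[ℂ] 𝔎 => T j.2)
    (α.isBase.commute _ (α.gram_mem i.1.2 j.1.2) _ hcc).eq
  have e2 : ((c)†) (c ((((i.1 : 𝔎 →L[ℂ] H))†) ((j.1 : 𝔎 →L[ℂ] H) j.2))) =
      (((i.1 : 𝔎 →L[ℂ] H))†) ((j.1 : 𝔎 →L[ℂ] H) (((c)†) (c j.2))) := hg2.symm
  simp only [hD, vec, sub_apply, smul_apply, ContinuousLinearMap.comp_apply,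
    ContinuousLinearMap.id_apply, inner_sub_right, inner_smul_right, e2]
  rw [ContinuousLinearMap.adjoint_inner_right, ← e1]
  rw [ContinuousLinearMap.adjoint_inner_right, ContinuousLinearMap.adjoint_inner_right]

/-- The representation `ρ_α : 𝔅† → L(H)`, given by `ρ_α(c) (ξ ζ) = ξ (c ζ)`. -/
def rho (α : BaseModule B Bd H) (c : Bd) : H →L[ℂ] H :=
  gramMap α.vec fun p => (p.1 : 𝔎 →L[ℂ] H) ((c : 𝔎 →L[ℂ] 𝔎) p.2)

theorem rho_apply (α : BaseModule B Bd H) (c : Bd) {ξ : 𝔎 →L[ℂ] H} (hξ : ξ ∈ α.space) (ζ : 𝔎) :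
    α.rho c (ξ ζ) = ξ ((c : 𝔎 →L[ℂ] 𝔎) ζ) :=
  gramMap_apply α.cspan_vec (norm_nonneg _) (α.rho_kernel c) (⟨⟨ξ, hξ⟩, ζ⟩ : α.space × 𝔎)

theorem norm_rho_le (α : BaseModule B Bd H) (c : Bd) : ‖α.rho c‖ ≤ ‖(c : 𝔎 →L[ℂ] 𝔎)‖ :=
  norm_gramMap_le α.cspan_vec (norm_nonneg _) (α.rho_kernel c)

theorem ext_vec (α : BaseModule B Bd H) {F : Type*} [NormedAddCommGroup F] [NormedSpace ℂ F]
    {S T : H →L[ℂ] F}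
    (h : ∀ ξ ∈ α.space, ∀ ζ, S (ξ ζ) = T (ξ ζ)) : S = T :=
  ext_of_cspan_eq_top α.cspan_vec fun p => h p.1 p.1.2 p.2

theorem rho_add (α : BaseModule B Bd H) (c d : Bd) : α.rho (c + d) = α.rho c + α.rho d :=
  α.ext_vec fun ξ hξ ζ => by simp [rho_apply _ _ hξ]

theorem rho_smul (α : BaseModule B Bd H) (r : ℂ) (c : Bd) : α.rho (r • c) = r • α.rho c :=
  α.ext_vec fun ξ hξ ζ => by simp [rho_apply _ _ hξ]

theorem rho_sub (α : BaseModule B Bd H) (c d : Bd) : α.rho (c - d) = α.rho c - α.rho d :=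
  α.ext_vec fun ξ hξ ζ => by simp [rho_apply _ _ hξ]

/-- If `Bd` is spanned by `S`, then membership of `ρ_α(c) ξ` in a closed subspace can be tested
on `S`. -/
theorem rho_mem_of_span (α : BaseModule B Bd H) {S : Set (𝔎 →L[ℂ] 𝔎)}
    (hS : (cspan S : Set (𝔎 →L[ℂ] 𝔎)) = Bd) {E : Type*} [NormedAddCommGroup E] [NormedSpace ℂ E]
    (f : (H →L[ℂ] H) →L[ℂ] E) {C : Submodule ℂ E} (hC : IsClosed (C : Set E))
    (h : ∀ c : Bd, (c : 𝔎 →L[ℂ] 𝔎) ∈ S → f (α.rho c) ∈ C) (c : Bd) : f (α.rho c) ∈ C := by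
  have hsub : ∀ b ∈ Submodule.span ℂ S, ∃ hb : b ∈ Bd, f (α.rho ⟨b, hb⟩) ∈ C := by
    intro b hb
    induction hb using Submodule.span_induction with
    | mem b hb =>
      have hb' : b ∈ (Bd : Set (𝔎 →L[ℂ] 𝔎)) := hS ▸ subset_cspan S hb
      exact ⟨hb', h ⟨b, hb'⟩ hb⟩
    | zero =>
      refine ⟨Bd.zero_mem, ?_⟩
      have : α.rho ⟨0, Bd.zero_mem⟩ = 0 := by
        have := α.rho_smul 0 (0 : Bd)
        rwa [zero_smul, zero_smul] at this
      rw [this, map_zero]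
      exact C.zero_mem
    | add x y _ _ hx hy =>
      obtain ⟨hx, hx'⟩ := hx
      obtain ⟨hy, hy'⟩ := hy
      refine ⟨Bd.add_mem hx hy, ?_⟩
      have := α.rho_add ⟨x, hx⟩ ⟨y, hy⟩
      rw [show (⟨x + y, Bd.add_mem hx hy⟩ : Bd) = ⟨x, hx⟩ + ⟨y, hy⟩ from rfl, this, map_add]
      exact C.add_mem hx' hy'
    | smul r x _ hx =>
      obtain ⟨hx, hx'⟩ := hx
      refine ⟨SMulMemClass.smul_mem r hx, ?_⟩
      have := α.rho_smul r ⟨x, hx⟩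
      rw [show (⟨r • x, SMulMemClass.smul_mem r hx⟩ : Bd) = r • ⟨x, hx⟩ from rfl, this, map_smul]
      exact C.smul_mem r hx'
  have hc : (c : 𝔎 →L[ℂ] 𝔎) ∈ closure (Submodule.span ℂ S : Set (𝔎 →L[ℂ] 𝔎)) := by
    have : (c : 𝔎 →L[ℂ] 𝔎) ∈ (cspan S : Set (𝔎 →L[ℂ] 𝔎)) := hS ▸ c.2
    exact this
  obtain ⟨u, hu, hlim⟩ := mem_closure_iff_seq_limit.1 hc
  choose hB hf using fun n => hsub (u n) (hu n)
  have hlim2 : Filter.Tendsto (fun n => α.rho ⟨u n, hB n⟩) Filter.atTop (nhds (α.rho c)) := by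
    rw [tendsto_iff_norm_sub_tendsto_zero] at hlim ⊢
    refine squeeze_zero (fun _ => norm_nonneg _) (fun n => ?_) hlim
    rw [← rho_sub]
    exact α.norm_rho_le _
  exact hC.mem_of_tendsto ((f.continuous.tendsto _).comp hlim2) (Filter.Eventually.of_forall hf)

end BaseModule

/-- The condition `[ρ_α(𝔅†) γ] = γ`. -/
def ActsOn {B' Bd' : NonUnitalStarSubalgebra ℂ (𝔎 →L[ℂ] 𝔎)} (α : BaseModule B Bd H)
    (γ : BaseModule B' Bd' H) : Prop :=
  cspan {x | ∃ c : Bd, ∃ ξ ∈ γ.space, α.rho c ∘L ξ = x} = γ.space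

theorem ActsOn.mem {B' Bd' : NonUnitalStarSubalgebra ℂ (𝔎 →L[ℂ] 𝔎)} {α : BaseModule B Bd H}
    {γ : BaseModule B' Bd' H} (h : ActsOn α γ) (c : Bd) {ξ : 𝔎 →L[ℂ] H} (hξ : ξ ∈ γ.space) :
    α.rho c ∘L ξ ∈ γ.space := by
  have : α.rho c ∘L ξ ∈ cspan {x | ∃ c : Bd, ∃ ξ ∈ γ.space, α.rho c ∘L ξ = x} :=
    subset_cspan _ ⟨c, ξ, hξ, rfl⟩
  rwa [h] at this

theorem ActsOn.commute {B' Bd' : NonUnitalStarSubalgebra ℂ (𝔎 →L[ℂ] 𝔎)} {α : BaseModule B Bd H}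
    {γ : BaseModule B' Bd' H} (h : ActsOn α γ) (c : Bd) (d : Bd') (v : H) :
    α.rho c (γ.rho d v) = γ.rho d (α.rho c v) := by
  have : α.rho c ∘L γ.rho d = γ.rho d ∘L α.rho c := γ.ext_vec fun ξ hξ ζ => by
    have h1 := γ.rho_apply d (h.mem c hξ) ζ
    simp only [ContinuousLinearMap.comp_apply] at h1 ⊢
    rw [γ.rho_apply d hξ, h1]
  exact congrArg (fun T : H →L[ℂ] H => T v) this

/-- The push-forward `[S α]` of a module along a set `S` of operators whose elements satisfy
`[S H] = X` and `[S* S α] = α`. -/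
def BaseModule.push (α : BaseModule B Bd H) (S : Set (H →L[ℂ] K))
    (h1 : cspan {k | ∃ s ∈ S, ∃ v, s v = k} = ⊤)
    (h2 : cspan {x | ∃ s ∈ S, ∃ t ∈ S, ∃ ξ ∈ α.space, ((s)† ∘L t) ∘L ξ = x} = α.space) :
    BaseModule B Bd K where
  isBase := α.isBase
  space := cspan {x | ∃ s ∈ S, ∃ ξ ∈ α.space, s ∘L ξ = x}
  isClosed := isClosed_cspan _
  span_apply := by
    refine cspan_eq_top_of_forall h1 ?_
    rintro _ ⟨s, hs, v, rfl⟩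
    refine cspan_map_mem s (isClosed_cspan _) (S := {h | ∃ ξ ∈ α.space, ∃ ζ, ξ ζ = h}) ?_ v
      (by rw [α.span_apply]; trivial)
    rintro _ ⟨ξ, hξ, ζ, rfl⟩
    exact subset_cspan _ ⟨s ∘L ξ, subset_cspan _ ⟨s, hs, ξ, hξ, rfl⟩, ζ, rfl⟩
  span_right := by
    refine le_antisymm (cspan_le (isClosed_cspan _) ?_) (cspan_le (isClosed_cspan _) ?_)
    · rintro _ ⟨x, hx, b, hb, rfl⟩
      refine cspan_map_mem ((ContinuousLinearMap.compL ℂ 𝔎 𝔎 K).flip b) (isClosed_cspan _) ?_ x hx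
      rintro _ ⟨s, hs, ξ, hξ, rfl⟩
      exact subset_cspan _ ⟨s, hs, ξ ∘L b, α.comp_mem hξ hb, rfl⟩
    · rintro _ ⟨s, hs, ξ, hξ, rfl⟩
      rw [← α.span_right] at hξ
      refine cspan_map_mem (ContinuousLinearMap.compL ℂ 𝔎 H K s) (isClosed_cspan _) ?_ ξ hξ
      rintro _ ⟨ξ, hξ, b, hb, rfl⟩
      exact subset_cspan _ ⟨s ∘L ξ, subset_cspan _ ⟨s, hs, ξ, hξ, rfl⟩, b, hb, rfl⟩
  span_gram := by
    rw [← α.span_gram]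
    refine congrArg _ (le_antisymm (cspan_le (isClosed_cspan _) ?_) (cspan_le (isClosed_cspan _) ?_))
    · have key : ∀ x ∈ cspan {x | ∃ s ∈ S, ∃ ξ ∈ α.space, s ∘L ξ = x}, ∀ t ∈ S, ∀ ξ' ∈ α.space,
          (ξ')† ∘L ((t)† ∘L x) ∈ cspan {b | ∃ ξ ∈ α.space, ∃ ξ' ∈ α.space, (ξ)† ∘L ξ' = b} := by
        intro x hx t ht ξ' hξ'
        refine cspan_map_mem (ContinuousLinearMap.compL ℂ 𝔎 H 𝔎 ((ξ')†) ∘L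
          ContinuousLinearMap.compL ℂ 𝔎 K H ((t)†)) (isClosed_cspan _) ?_ x hx
        rintro _ ⟨s, hs, ξ, hξ, rfl⟩
        have : (t)† ∘L (s ∘L ξ) ∈ α.space := by
          rw [← h2]
          exact subset_cspan _ ⟨t, ht, s, hs, ξ, hξ, rfl⟩
        exact subset_cspan _ ⟨ξ', hξ', _, this, rfl⟩
      have hB : ∀ z : 𝔎 →L[ℂ] 𝔎,
          z ∈ cspan {b | ∃ ξ ∈ α.space, ∃ ξ' ∈ α.space, (ξ)† ∘L ξ' = b} ↔ z ∈ B := by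
        intro z
        rw [← SetLike.mem_coe, α.span_gram, SetLike.mem_coe]
      rintro _ ⟨y, hy, x, hx, rfl⟩
      have hstar : (x)† ∘L y ∈ cspan {b | ∃ ξ ∈ α.space, ∃ ξ' ∈ α.space, (ξ)† ∘L ξ' = b} := by
        refine cspan_map_mem (ContinuousLinearMap.compL ℂ 𝔎 K 𝔎 ((x)†)) (isClosed_cspan _) ?_ y hy
        rintro _ ⟨t, ht, ξ', hξ', rfl⟩
        have h4 := star_mem ((hB _).1 (key x hx t ht ξ' hξ'))
        refine (hB _).2 ?_
        convert h4 using 1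
        change _ = ((ξ')† ∘L ((t)† ∘L x))†
        simp [ContinuousLinearMap.adjoint_comp, ContinuousLinearMap.comp_assoc]
      have h4 := star_mem ((hB _).1 hstar)
      refine (hB _).2 ?_
      convert h4 using 1
      change _ = ((x)† ∘L y)†
      simp [ContinuousLinearMap.adjoint_comp]
    · rintro _ ⟨ξ, hξ, ξ', hξ', rfl⟩
      rw [← h2] at hξ'
      refine cspan_map_mem (ContinuousLinearMap.compL ℂ 𝔎 H 𝔎 ((ξ)†)) (isClosed_cspan _) ?_ ξ' hξ'
      rintro _ ⟨s, hs, t, ht, η, hη, rfl⟩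
      refine subset_cspan _ ⟨s ∘L ξ, subset_cspan _ ⟨s, hs, ξ, hξ, rfl⟩, t ∘L η,
        subset_cspan _ ⟨t, ht, η, hη, rfl⟩, ?_⟩
      simp [ContinuousLinearMap.adjoint_comp, ContinuousLinearMap.comp_assoc]

/-! ### The relative tensor product -/

/-- The index set of the elementary tensors `ξ ⊗ ζ ⊗ η`. -/
abbrev RTPIndex (β : BaseModule B Bd H) (γ : BaseModule Bd B K) : Type _ :=
  β.space × 𝔎 × γ.space

/-- The kernel `⟨ξ ⊗ ζ ⊗ η | ξ' ⊗ ζ' ⊗ η'⟩ = ⟨ζ | ξ* ξ' η* η' ζ'⟩`. -/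
def rtpKernel (β : BaseModule B Bd H) (γ : BaseModule Bd B K) (p q : RTPIndex β γ) : ℂ :=
  ⟪p.2.1, ((p.1 : 𝔎 →L[ℂ] H)† ∘L (q.1 : 𝔎 →L[ℂ] H))
    (((p.2.2 : 𝔎 →L[ℂ] K)† ∘L (q.2.2 : 𝔎 →L[ℂ] K)) q.2.1)⟫_ℂ

theorem gram_commute (β : BaseModule B Bd H) (γ : BaseModule Bd B K) {ξ ξ' : 𝔎 →L[ℂ] H}
    (hξ : ξ ∈ β.space) (hξ' : ξ' ∈ β.space) {η η' : 𝔎 →L[ℂ] K} (hη : η ∈ γ.space)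
    (hη' : η' ∈ γ.space) : Commute ((ξ)† ∘L ξ') ((η)† ∘L η') :=
  β.isBase.commute _ (β.gram_mem hξ hξ') _ (γ.gram_mem hη hη')

theorem isPSD_rtpKernel (β : BaseModule B Bd H) (γ : BaseModule Bd B K) :
    IsPSD (rtpKernel β γ) where
  conj_symm p q := by
    have h := congrArg (fun T : 𝔎 →L[ℂ] 𝔎 => T p.2.1)
      (gram_commute β γ q.1.2 p.1.2 q.2.2.2 p.2.2.2).eq
    simp only [mul_apply_eq_comp] at h
    simp only [rtpKernel]
    rw [inner_conj_symm, h]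
    simp only [ContinuousLinearMap.comp_apply]
    rw [ContinuousLinearMap.adjoint_inner_left, ← ContinuousLinearMap.adjoint_inner_right,
      ContinuousLinearMap.adjoint_inner_left, ContinuousLinearMap.adjoint_inner_right]
  nonneg := kerNonneg_schur (ι := RTPIndex β γ) (fun p => (p.1 : 𝔎 →L[ℂ] H))
    (fun p => (p.2.2 : 𝔎 →L[ℂ] K))
    (fun i j k l => gram_commute β γ i.1.2 j.1.2 k.2.2.2 l.2.2.2) (fun p => p.2.1)

/-- The relative tensor product `H_β ⊗_𝔟 {}_γ K` of a `C*`-`𝔟`-module `H_β` and a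
`C*`-`𝔟†`-module `K_γ`: the Hilbert space `β ⊗ 𝔎 ⊗ γ` spanned by the elementary tensors
`ξ ⊗ ζ ⊗ η`. -/
def RTP (β : BaseModule B Bd H) (γ : BaseModule Bd B K) : Type _ :=
  GramSpace (isPSD_rtpKernel β γ)

namespace RTP

instance (β : BaseModule B Bd H) (γ : BaseModule Bd B K) : NormedAddCommGroup (RTP β γ) :=
  inferInstanceAs (NormedAddCommGroup (GramSpace (isPSD_rtpKernel β γ)))
instance (β : BaseModule B Bd H) (γ : BaseModule Bd B K) : InnerProductSpace ℂ (RTP β γ) :=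
  inferInstanceAs (InnerProductSpace ℂ (GramSpace (isPSD_rtpKernel β γ)))
instance (β : BaseModule B Bd H) (γ : BaseModule Bd B K) : CompleteSpace (RTP β γ) :=
  inferInstanceAs (CompleteSpace (GramSpace (isPSD_rtpKernel β γ)))

/-- The elementary tensor `ξ ⊗ ζ ⊗ η`, for `p = (ξ, ζ, η)`. -/
def tmul (β : BaseModule B Bd H) (γ : BaseModule Bd B K) (p : RTPIndex β γ) : RTP β γ :=
  GramSpace.gen (isPSD_rtpKernel β γ) p

theorem inner_tmul (β : BaseModule B Bd H) (γ : BaseModule Bd B K) (p q : RTPIndex β γ) :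
    ⟪tmul β γ p, tmul β γ q⟫_ℂ = rtpKernel β γ p q :=
  GramSpace.inner_gen _ p q

theorem cspan_tmul (β : BaseModule B Bd H) (γ : BaseModule Bd B K) :
    cspan (Set.range (tmul β γ)) = ⊤ :=
  GramSpace.cspan_gen _

/-- The flip `ξ ⊗ ζ ⊗ η ↦ η ⊗ ζ ⊗ ξ`. -/
def flip (β : BaseModule B Bd H) (γ : BaseModule Bd B K) : RTP β γ ≃ₗᵢ[ℂ] RTP γ β :=
  gramEquiv (tmul β γ) (fun p => tmul γ β (p.2.2, p.2.1, p.1)) (cspan_tmul β γ)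
    (by
      rw [← cspan_tmul γ β]
      congr 1
      ext v
      constructor
      · rintro ⟨p, rfl⟩
        exact ⟨_, rfl⟩
      · rintro ⟨p, rfl⟩
        exact ⟨(p.2.2, p.2.1, p.1), rfl⟩)
    (fun p q => by
      rw [inner_tmul, inner_tmul]
      exact congrArg (fun T : 𝔎 →L[ℂ] 𝔎 => ⟪p.2.1, T q.2.1⟫_ℂ)
        (gram_commute β γ p.1.2 q.1.2 p.2.2.2 q.2.2.2).eq)

theorem flip_tmul (β : BaseModule B Bd H) (γ : BaseModule Bd B K) (p : RTPIndex β γ) :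
    flip β γ (tmul β γ p) = tmul γ β (p.2.2, p.2.1, p.1) :=
  gramEquiv_apply _ _ _ p

theorem ket_kernel (β : BaseModule B Bd H) (γ : BaseModule Bd B K) (η : γ.space) :
    KerNonneg fun i j : β.space × 𝔎 => ((‖(η : 𝔎 →L[ℂ] K)‖ : ℝ) : ℂ) ^ 2 *
      ⟪β.vec i, β.vec j⟫_ℂ -
      ⟪tmul β γ (i.1, i.2, η), tmul β γ (j.1, j.2, η)⟫_ℂ := by
  obtain ⟨D, hD⟩ := exists_defect (η : 𝔎 →L[ℂ] K)
  have h := kerNonneg_schur (ι := β.space × 𝔎) (fun i => (i.1 : 𝔎 →L[ℂ] H)) (fun _ => D)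
    (fun i j k l => by
      rw [hD]
      exact ((Commute.one_right _).smul_right _).sub_right
        (gram_commute β γ i.1.2 j.1.2 η.2 η.2))
    (fun i => i.2)
  refine (congrArg KerNonneg ?_).mp h
  funext i j
  rw [inner_tmul]
  simp only [hD, rtpKernel, BaseModule.vec, sub_apply, smul_apply, map_sub, map_smul,
    ContinuousLinearMap.comp_apply, ContinuousLinearMap.id_apply, inner_sub_right,
    inner_smul_right]
  rw [ContinuousLinearMap.adjoint_inner_right]

/-- The ket operator `|η⟩₂ : H → H_β ⊗ {}_γ K`, `ξ ζ ↦ ξ ⊗ ζ ⊗ η`. -/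
def ket₂ (β : BaseModule B Bd H) (γ : BaseModule Bd B K) (η : γ.space) : H →L[ℂ] RTP β γ :=
  gramMap β.vec fun p => tmul β γ (p.1, p.2, η)

theorem ket₂_apply (β : BaseModule B Bd H) (γ : BaseModule Bd B K) (η : γ.space) (ξ : β.space)
    (ζ : 𝔎) : ket₂ β γ η ((ξ : 𝔎 →L[ℂ] H) ζ) = tmul β γ (ξ, ζ, η) :=
  gramMap_apply β.cspan_vec (norm_nonneg _) (ket_kernel β γ η) (ξ, ζ)

/-- The ket operator `|ξ⟩₁ : K → H_β ⊗ {}_γ K`, `η ζ ↦ ξ ⊗ ζ ⊗ η`. -/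
def ket₁ (β : BaseModule B Bd H) (γ : BaseModule Bd B K) (ξ : β.space) : K →L[ℂ] RTP β γ :=
  (flip γ β : RTP γ β →L[ℂ] RTP β γ) ∘L ket₂ γ β ξ

theorem ket₁_apply (β : BaseModule B Bd H) (γ : BaseModule Bd B K) (ξ : β.space) (η : γ.space)
    (ζ : 𝔎) : ket₁ β γ ξ ((η : 𝔎 →L[ℂ] K) ζ) = tmul β γ (ξ, ζ, η) := by
  change flip γ β (ket₂ γ β ξ ((η : 𝔎 →L[ℂ] K) ζ)) = _
  rw [ket₂_apply, flip_tmul]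

theorem adjoint_ket₂_comp (β : BaseModule B Bd H) (γ : BaseModule Bd B K) (η η' : γ.space) :
    (ket₂ β γ η)† ∘L ket₂ β γ η' =
      β.rho ⟨(η : 𝔎 →L[ℂ] K)† ∘L (η' : 𝔎 →L[ℂ] K), γ.gram_mem η.2 η'.2⟩ := by
  refine β.ext_vec fun ξ' hξ' ζ' => ?_
  refine ext_inner_left ℂ fun v => ?_
  have key : (innerSL ℂ (((ket₂ β γ η)† ∘L ket₂ β γ η') (ξ' ζ'))) =
      innerSL ℂ (β.rho ⟨(η : 𝔎 →L[ℂ] K)† ∘L (η' : 𝔎 →L[ℂ] K), γ.gram_mem η.2 η'.2⟩ (ξ' ζ')) := by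
    refine β.ext_vec fun ξ hξ ζ => ?_
    rw [innerSL_apply_apply, innerSL_apply_apply]
    refine (inner_conj_symm _ _).symm.trans ((congrArg conj ?_).trans (inner_conj_symm _ _))
    have h1 := ket₂_apply β γ η' ⟨ξ', hξ'⟩ ζ'
    have h2 := ket₂_apply β γ η ⟨ξ, hξ⟩ ζ
    simp only at h1 h2
    rw [ContinuousLinearMap.comp_apply, ContinuousLinearMap.adjoint_inner_right, h1, h2,
      β.rho_apply _ hξ', inner_tmul, rtpKernel, ContinuousLinearMap.comp_apply,
      ContinuousLinearMap.adjoint_inner_right]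
  have := congrArg (fun T : H →L[ℂ] ℂ => conj (T v)) key
  simpa [innerSL_apply_apply, inner_conj_symm] using this

theorem adjoint_ket₁_comp (β : BaseModule B Bd H) (γ : BaseModule Bd B K) (ξ ξ' : β.space) :
    (ket₁ β γ ξ)† ∘L ket₁ β γ ξ' =
      γ.rho ⟨(ξ : 𝔎 →L[ℂ] H)† ∘L (ξ' : 𝔎 →L[ℂ] H), β.gram_mem ξ.2 ξ'.2⟩ := by
  rw [← adjoint_ket₂_comp γ β ξ ξ']
  refine ContinuousLinearMap.ext fun v => ext_inner_left ℂ fun w => ?_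
  simp only [ContinuousLinearMap.comp_apply, ContinuousLinearMap.adjoint_inner_right, ket₁]
  exact (flip γ β).inner_map_map _ _

theorem cspan_ket₂ (β : BaseModule B Bd H) (γ : BaseModule Bd B K) :
    cspan {x | ∃ s ∈ Set.range (ket₂ β γ), ∃ v, s v = x} = ⊤ := by
  refine cspan_eq_top_of_forall (cspan_tmul β γ) ?_
  rintro _ ⟨⟨ξ, ζ, η⟩, rfl⟩
  exact subset_cspan _ ⟨_, ⟨η, rfl⟩, (ξ : 𝔎 →L[ℂ] H) ζ, ket₂_apply β γ η ξ ζ⟩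

theorem cspan_ket₁ (β : BaseModule B Bd H) (γ : BaseModule Bd B K) :
    cspan {x | ∃ s ∈ Set.range (ket₁ β γ), ∃ v, s v = x} = ⊤ := by
  refine cspan_eq_top_of_forall (cspan_tmul β γ) ?_
  rintro _ ⟨⟨ξ, ζ, η⟩, rfl⟩
  exact subset_cspan _ ⟨_, ⟨ξ, rfl⟩, (η : 𝔎 →L[ℂ] K) ζ, ket₁_apply β γ ξ η ζ⟩

variable {B' Bd' : NonUnitalStarSubalgebra ℂ (𝔎 →L[ℂ] 𝔎)}

/-- The module structure `α ◁ γ = [|γ⟩₂ α]` on `H_β ⊗ {}_γ K`, for a `C*`-module `H_α`. -/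
def ltri (α : BaseModule B' Bd' H) (β : BaseModule B Bd H) (γ : BaseModule Bd B K)
    (h : ActsOn β α) : BaseModule B' Bd' (RTP β γ) :=
  α.push (Set.range (ket₂ β γ)) (cspan_ket₂ β γ) (by
    refine le_antisymm (cspan_le α.isClosed ?_) ?_
    · rintro _ ⟨_, ⟨η, rfl⟩, _, ⟨η', rfl⟩, ξ, hξ, rfl⟩
      rw [adjoint_ket₂_comp]
      exact h.mem _ hξ
    · rw [← h]
      refine cspan_le (isClosed_cspan _) ?_
      rintro _ ⟨c, ξ, hξ, rfl⟩
      refine β.rho_mem_of_span γ.span_gram ((ContinuousLinearMap.compL ℂ 𝔎 H H).flip ξ)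
        (isClosed_cspan _) ?_ c
      rintro ⟨_, hc⟩ ⟨η, hη, η', hη', rfl⟩
      refine subset_cspan _ ⟨_, ⟨⟨η, hη⟩, rfl⟩, _, ⟨⟨η', hη'⟩, rfl⟩, ξ, ?_, ?_⟩
      · rw [h]
        exact hξ
      · rw [adjoint_ket₂_comp]
        rfl)

/-- The module structure `β ▷ δ = [|β⟩₁ δ]` on `H_β ⊗ {}_γ K`, for a `C*`-module `K_δ`. -/
def rtri (β : BaseModule B Bd H) (γ : BaseModule Bd B K) (δ : BaseModule B' Bd' K)
    (h : ActsOn γ δ) : BaseModule B' Bd' (RTP β γ) :=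
  δ.push (Set.range (ket₁ β γ)) (cspan_ket₁ β γ) (by
    refine le_antisymm (cspan_le δ.isClosed ?_) ?_
    · rintro _ ⟨_, ⟨η, rfl⟩, _, ⟨η', rfl⟩, ξ, hξ, rfl⟩
      rw [adjoint_ket₁_comp]
      exact h.mem _ hξ
    · rw [← h]
      refine cspan_le (isClosed_cspan _) ?_
      rintro _ ⟨c, ξ, hξ, rfl⟩
      refine γ.rho_mem_of_span β.span_gram ((ContinuousLinearMap.compL ℂ 𝔎 K K).flip ξ)
        (isClosed_cspan _) ?_ c
      rintro ⟨_, hc⟩ ⟨η, hη, η', hη', rfl⟩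
      refine subset_cspan _ ⟨_, ⟨⟨η, hη⟩, rfl⟩, _, ⟨⟨η', hη'⟩, rfl⟩, ξ, ?_, ?_⟩
      · rw [h]
        exact hξ
      · rw [adjoint_ket₁_comp]
        rfl)

end RTP

/-! ### Functoriality with respect to unitaries, and associativity -/

/-- The relation `W α = γ`, for a unitary `W`. -/
def Intertwines {B' Bd' : NonUnitalStarSubalgebra ℂ (𝔎 →L[ℂ] 𝔎)} (W : H ≃ₗᵢ[ℂ] K)
    (α : BaseModule B Bd H) (γ : BaseModule B' Bd' K) : Prop :=
  (fun ξ : 𝔎 →L[ℂ] H => (W : H →L[ℂ] K) ∘L ξ) '' (α.space : Set (𝔎 →L[ℂ] H)) = γ.space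

namespace Intertwines

variable {W : H ≃ₗᵢ[ℂ] K} {α : BaseModule B Bd H} {γ : BaseModule B Bd K}

theorem mem (h : Intertwines W α γ) (ξ : α.space) :
    (W : H →L[ℂ] K) ∘L (ξ : 𝔎 →L[ℂ] H) ∈ γ.space :=
  (Set.ext_iff.1 h _).1 ⟨ξ, ξ.2, rfl⟩

theorem of_push {X : Type*} [NormedAddCommGroup X] [InnerProductSpace ℂ X] [CompleteSpace X]
    (W : H ≃ₗᵢ[ℂ] K) (α : BaseModule B Bd X) {S : Set (X →L[ℂ] H)} {T : Set (X →L[ℂ] K)}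
    (h1 : cspan {k | ∃ s ∈ S, ∃ v, s v = k} = ⊤)
    (h2 : cspan {x | ∃ s ∈ S, ∃ t ∈ S, ∃ ξ ∈ α.space, ((s)† ∘L t) ∘L ξ = x} = α.space)
    (h1' : cspan {k | ∃ s ∈ T, ∃ v, s v = k} = ⊤)
    (h2' : cspan {x | ∃ s ∈ T, ∃ t ∈ T, ∃ ξ ∈ α.space, ((s)† ∘L t) ∘L ξ = x} = α.space)
    (hST : ∀ s ∈ S, (W : H →L[ℂ] K) ∘L s ∈ T)
    (hTS : ∀ t ∈ T, (W.symm : K →L[ℂ] H) ∘L t ∈ S) :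
    Intertwines W (α.push S h1 h2) (α.push T h1' h2') := by
  refine Set.Subset.antisymm ?_ ?_
  · rintro _ ⟨x, hx, rfl⟩
    refine cspan_map_mem (ContinuousLinearMap.compL ℂ 𝔎 H K (W : H →L[ℂ] K)) (isClosed_cspan _)
      ?_ x hx
    rintro _ ⟨s, hs, ξ, hξ, rfl⟩
    exact subset_cspan _ ⟨_, hST s hs, ξ, hξ, rfl⟩
  · intro y hy
    refine ⟨(W.symm : K →L[ℂ] H) ∘L y, ?_, ?_⟩
    · refine cspan_map_mem (ContinuousLinearMap.compL ℂ 𝔎 K H (W.symm : K →L[ℂ] H))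
        (isClosed_cspan _) ?_ y hy
      rintro _ ⟨t, ht, ξ, hξ, rfl⟩
      exact subset_cspan _ ⟨_, hTS t ht, ξ, hξ, rfl⟩
    · ext v
      simp

end Intertwines

namespace RTP

variable {B₂ Bd₂ : NonUnitalStarSubalgebra ℂ (𝔎 →L[ℂ] 𝔎)}

theorem flip_flip (β : BaseModule B Bd H) (γ : BaseModule Bd B K) (v : RTP β γ) :
    flip γ β (flip β γ v) = v := by
  have : ((flip γ β : RTP γ β →L[ℂ] RTP β γ) ∘L (flip β γ : RTP β γ →L[ℂ] RTP γ β)) =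
      ContinuousLinearMap.id ℂ _ := by
    refine ext_of_cspan_eq_top (cspan_tmul β γ) fun p => ?_
    change flip γ β (flip β γ (tmul β γ p)) = tmul β γ p
    rw [flip_tmul, flip_tmul]
  exact congrArg (fun T : RTP β γ →L[ℂ] RTP β γ => T v) this

theorem flip_intertwines_rtri (β : BaseModule B Bd H) (γ : BaseModule Bd B K)
    (δ : BaseModule B₂ Bd₂ K) (h : ActsOn γ δ) :
    Intertwines (flip β γ) (rtri β γ δ h) (ltri δ γ β h) := by
  refine Intertwines.of_push _ _ _ _ _ _ ?_ ?_
  · rintro _ ⟨ξ, rfl⟩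
    refine ⟨ξ, ?_⟩
    ext v
    exact (flip_flip γ β _).symm
  · rintro _ ⟨ξ, rfl⟩
    refine ⟨ξ, ?_⟩
    ext v
    refine (flip β γ).injective ?_
    change flip β γ (flip γ β _) = flip β γ ((flip β γ).symm _)
    rw [LinearIsometryEquiv.apply_symm_apply, flip_flip]

theorem flip_intertwines_ltri (α : BaseModule B₂ Bd₂ H) (β : BaseModule B Bd H)
    (γ : BaseModule Bd B K) (h : ActsOn β α) :
    Intertwines (flip β γ) (ltri α β γ h) (rtri γ β α h) := by
  refine Intertwines.of_push _ _ _ _ _ _ ?_ ?_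
  · rintro _ ⟨η, rfl⟩
    exact ⟨η, rfl⟩
  · rintro _ ⟨η, rfl⟩
    refine ⟨η, ?_⟩
    ext v
    exact ((flip β γ).symm_apply_apply _).symm

/-- The unitary `W ⊗ 1 : ξ ⊗ ζ ⊗ η ↦ W ξ ⊗ ζ ⊗ η`, for a unitary `W` with `W β = β'`. -/
def mapLeft (W : H ≃ₗᵢ[ℂ] L) {β : BaseModule B Bd H} {β' : BaseModule B Bd L}
    (hW : Intertwines W β β') (γ : BaseModule Bd B K) : RTP β γ ≃ₗᵢ[ℂ] RTP β' γ :=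
  gramEquiv (tmul β γ) (fun p => tmul β' γ (⟨_, hW.mem p.1⟩, p.2.1, p.2.2)) (cspan_tmul β γ)
    (by
      rw [← cspan_tmul β' γ]
      congr 1
      ext v
      constructor
      · rintro ⟨p, rfl⟩
        exact ⟨_, rfl⟩
      · rintro ⟨⟨⟨ξ', hξ'⟩, ζ, η⟩, rfl⟩
        obtain ⟨ξ, hξ, rfl⟩ := (Set.ext_iff.1 hW ξ').2 hξ'
        exact ⟨(⟨ξ, hξ⟩, ζ, η), rfl⟩)
    (fun p q => by
      rw [inner_tmul, inner_tmul]
      simp only [rtpKernel]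
      refine congrArg (fun T : 𝔎 →L[ℂ] 𝔎 => ⟪p.2.1, T
        (((p.2.2 : 𝔎 →L[ℂ] K)† ∘L (q.2.2 : 𝔎 →L[ℂ] K)) q.2.1)⟫_ℂ) ?_
      refine ContinuousLinearMap.ext fun v => ext_inner_left ℂ fun w => ?_
      simp only [ContinuousLinearMap.comp_apply, ContinuousLinearMap.adjoint_inner_right]
      exact (W.inner_map_map _ _).symm)

theorem mapLeft_tmul (W : H ≃ₗᵢ[ℂ] L) {β : BaseModule B Bd H} {β' : BaseModule B Bd L}
    (hW : Intertwines W β β') (γ : BaseModule Bd B K) (p : RTPIndex β γ) :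
    mapLeft W hW γ (tmul β γ p) = tmul β' γ (⟨_, hW.mem p.1⟩, p.2.1, p.2.2) :=
  gramEquiv_apply _ _ _ p

/-- The unitary `1 ⊗ W : ξ ⊗ ζ ⊗ η ↦ ξ ⊗ ζ ⊗ W η`, for a unitary `W` with `W γ = γ'`. -/
def mapRight (β : BaseModule B Bd H) (W : K ≃ₗᵢ[ℂ] L) {γ : BaseModule Bd B K}
    {γ' : BaseModule Bd B L} (hW : Intertwines W γ γ') : RTP β γ ≃ₗᵢ[ℂ] RTP β γ' :=
  ((flip β γ).trans (mapLeft W hW β)).trans (flip γ' β)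

theorem mapRight_tmul (β : BaseModule B Bd H) (W : K ≃ₗᵢ[ℂ] L) {γ : BaseModule Bd B K}
    {γ' : BaseModule Bd B L} (hW : Intertwines W γ γ') (p : RTPIndex β γ) :
    mapRight β W hW (tmul β γ p) = tmul β γ' (p.1, p.2.1, ⟨_, hW.mem p.2.2⟩) := by
  simp only [mapRight, LinearIsometryEquiv.trans_apply]
  rw [flip_tmul, mapLeft_tmul, flip_tmul]

section Assoc

variable (β : BaseModule B Bd H) (γ : BaseModule Bd B K) (ε : BaseModule B₂ Bd₂ K)
  (φ : BaseModule Bd₂ B₂ L) (h₁ : ActsOn γ ε) (h₂ : ActsOn ε γ)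

theorem rho_rtri (c : Bd₂) (ξ : β.space) (k : K) :
    (rtri β γ ε h₁).rho c (ket₁ β γ ξ k) = ket₁ β γ ξ (ε.rho c k) := by
  have : (rtri β γ ε h₁).rho c ∘L ket₁ β γ ξ = ket₁ β γ ξ ∘L ε.rho c := by
    refine ε.ext_vec fun x hx ζ => ?_
    have hm : ket₁ β γ ξ ∘L x ∈ (rtri β γ ε h₁).space := subset_cspan _ ⟨_, ⟨ξ, rfl⟩, x, hx, rfl⟩
    have := (rtri β γ ε h₁).rho_apply c hm ζ
    simp only [ContinuousLinearMap.comp_apply] at this ⊢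
    rw [this, ε.rho_apply c hx]
  exact congrArg (fun T : K →L[ℂ] RTP β γ => T k) this

theorem rho_ltri (c : B) (η : φ.space) (k : K) :
    (ltri γ ε φ h₂).rho c (ket₂ ε φ η k) = ket₂ ε φ η (γ.rho c k) := by
  have : (ltri γ ε φ h₂).rho c ∘L ket₂ ε φ η = ket₂ ε φ η ∘L γ.rho c := by
    refine γ.ext_vec fun x hx ζ => ?_
    have hm : ket₂ ε φ η ∘L x ∈ (ltri γ ε φ h₂).space :=
      subset_cspan _ ⟨_, ⟨η, rfl⟩, x, hx, rfl⟩
    have := (ltri γ ε φ h₂).rho_apply c hm ζ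
    simp only [ContinuousLinearMap.comp_apply] at this ⊢
    rw [this, γ.rho_apply c hx]
  exact congrArg (fun T : K →L[ℂ] RTP ε φ => T k) this

theorem inner_ket₂ (η η' : γ.space) (v w : H) :
    ⟪ket₂ β γ η v, ket₂ β γ η' w⟫_ℂ =
      ⟪v, β.rho ⟨(η : 𝔎 →L[ℂ] K)† ∘L (η' : 𝔎 →L[ℂ] K), γ.gram_mem η.2 η'.2⟩ w⟫_ℂ := by
  rw [← adjoint_ket₂_comp, ContinuousLinearMap.comp_apply, ContinuousLinearMap.adjoint_inner_right]

theorem inner_ket₁ (ξ ξ' : β.space) (v w : K) :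
    ⟪ket₁ β γ ξ v, ket₁ β γ ξ' w⟫_ℂ =
      ⟪v, γ.rho ⟨(ξ : 𝔎 →L[ℂ] H)† ∘L (ξ' : 𝔎 →L[ℂ] H), β.gram_mem ξ.2 ξ'.2⟩ w⟫_ℂ := by
  rw [← adjoint_ket₁_comp, ContinuousLinearMap.comp_apply, ContinuousLinearMap.adjoint_inner_right]

/-- The associativity isomorphism
`(H_β ⊗ {}_γ K)_{β ▷ ε} ⊗ {}_φ L ≅ H_β ⊗ {}_{γ ◁ φ} (K_ε ⊗ {}_φ L)`: both spaces are identified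
with `β ⊗ K ⊗ φ`, that is, `|η⟩₂ |ξ⟩₁ k ↦ |ξ⟩₁ |η⟩₂ k` for `ξ ∈ β`, `k ∈ K`, `η ∈ φ`. -/
def assoc : RTP (rtri β γ ε h₁) φ ≃ₗᵢ[ℂ] RTP β (ltri γ ε φ h₂) :=
  gramEquiv (ι := β.space × K × φ.space)
    (fun p => ket₂ (rtri β γ ε h₁) φ p.2.2 (ket₁ β γ p.1 p.2.1))
    (fun p => ket₁ β (ltri γ ε φ h₂) p.1 (ket₂ ε φ p.2.2 p.2.1))
    (by
      refine cspan_eq_top_of_forall (cspan_ket₂ (rtri β γ ε h₁) φ) ?_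
      rintro _ ⟨_, ⟨η, rfl⟩, v, rfl⟩
      refine cspan_map_mem (ket₂ (rtri β γ ε h₁) φ η) (isClosed_cspan _) ?_ v
        (by rw [cspan_ket₁ β γ]; trivial)
      rintro _ ⟨_, ⟨ξ, rfl⟩, k, rfl⟩
      exact subset_cspan _ ⟨(ξ, k, η), rfl⟩)
    (by
      refine cspan_eq_top_of_forall (cspan_ket₁ β (ltri γ ε φ h₂)) ?_
      rintro _ ⟨_, ⟨ξ, rfl⟩, v, rfl⟩
      refine cspan_map_mem (ket₁ β (ltri γ ε φ h₂) ξ) (isClosed_cspan _) ?_ v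
        (by rw [cspan_ket₂ ε φ]; trivial)
      rintro _ ⟨_, ⟨η, rfl⟩, k, rfl⟩
      exact subset_cspan _ ⟨(ξ, k, η), rfl⟩)
    (fun p q => by
      rw [inner_ket₂, rho_rtri, inner_ket₁, inner_ket₁, rho_ltri, inner_ket₂, h₁.commute])

theorem assoc_apply (ξ : β.space) (k : K) (η : φ.space) :
    assoc β γ ε φ h₁ h₂ (ket₂ (rtri β γ ε h₁) φ η (ket₁ β γ ξ k)) =
      ket₁ β (ltri γ ε φ h₂) ξ (ket₂ ε φ η k) :=
  gramEquiv_apply (ι := β.space × K × φ.space) _ _ _ (ξ, k, η)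

end Assoc

end RTP

/-! ### `C*`-pseudo-multiplicative unitaries -/

/-- `(H, βh, α, β)` is a `C*`-`(𝔟†, 𝔟, 𝔟†)`-module. -/
structure IsTriModule (βh : BaseModule Bd B H) (α : BaseModule B Bd H) (β : BaseModule Bd B H) :
    Prop where
  βh_α : ActsOn βh α
  βh_β : ActsOn βh β
  α_βh : ActsOn α βh
  α_β : ActsOn α β
  β_βh : ActsOn β βh
  β_α : ActsOn β α

section PMU

open RTP

variable {βh : BaseModule Bd B H} {α : BaseModule B Bd H} {β : BaseModule Bd B H}

/-- The leg operator `V₁₃` from `H_βh ⊗ {}_{α ▷ α} (H_α ⊗ {}_β H)` to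
`(H_βh ⊗ {}_α H)_{α ◁ α} ⊗ {}_β H`, for a unitary `V` with `V (βh ▷ β) = βh ◁ β`: exchange the
second and the third leg, apply `V ⊗ 1`, and exchange the legs again. -/
def leg₁₃ (hm : IsTriModule βh α β) (V : RTP βh α ≃ₗᵢ[ℂ] RTP α β)
    (hV : Intertwines V (rtri βh α β hm.α_β) (ltri βh α β hm.α_βh)) :
    RTP βh (rtri α β α hm.β_α) ≃ₗᵢ[ℂ] RTP (ltri α βh α hm.βh_α) β :=
  (mapRight βh (flip α β) (flip_intertwines_rtri α β α hm.β_α)).trans <|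
  (assoc βh α β α hm.α_β hm.β_α).symm.trans <|
  (mapLeft V hV α).trans <|
  (mapLeft (flip α β) (flip_intertwines_ltri βh α β hm.α_βh) α).trans <|
  (assoc β α βh α hm.α_βh hm.βh_α).trans <|
  flip β (ltri α βh α hm.βh_α)

/-- `V : H_βh ⊗_{𝔟†} {}_α H → H_α ⊗_𝔟 {}_β H` is a `C*`-pseudo-multiplicative unitary: it satisfies
the four intertwining relations and the pentagon equation `V₂₃ V₁₂ = V₁₂ V₁₃ V₂₃`. -/
structure IsPMU (hm : IsTriModule βh α β) (V : RTP βh α ≃ₗᵢ[ℂ] RTP α β) : Prop where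
  map_α_α : Intertwines V (ltri α βh α hm.βh_α) (rtri α β α hm.β_α)
  map_βh_β : Intertwines V (rtri βh α β hm.α_β) (ltri βh α β hm.α_βh)
  map_βh_βh : Intertwines V (rtri βh α βh hm.α_βh) (rtri α β βh hm.β_βh)
  map_β_α : Intertwines V (ltri β βh α hm.βh_β) (ltri β α β hm.α_β)
  pentagon : ∀ x : RTP (rtri βh α βh hm.α_βh) α,
    mapRight α V map_β_α (assoc α β βh α hm.β_βh hm.βh_β (mapLeft V map_βh_βh α x)) =
      assoc α β α β hm.β_α hm.α_β
        (mapLeft V map_α_α β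
          (leg₁₃ hm V map_βh_β
            (mapRight βh V map_α_α (assoc βh α βh α hm.α_βh hm.βh_α x))))

/-- The right leg `A(V) = [⟨α|₁ V |βh⟩₁]`. -/
def legA (V : RTP βh α ≃ₗᵢ[ℂ] RTP α β) : Submodule ℂ (H →L[ℂ] H) :=
  cspan {a | ∃ (ξ : α.space) (η : βh.space),
    (ket₁ α β ξ)† ∘L (V : RTP βh α →L[ℂ] RTP α β) ∘L ket₁ βh α η = a}

/-- The left leg `Â(V) = [⟨β|₂ V |α⟩₂]`. -/
def legAhat (V : RTP βh α ≃ₗᵢ[ℂ] RTP α β) : Submodule ℂ (H →L[ℂ] H) :=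
  cspan {a | ∃ (η : β.space) (ξ : α.space),
    (ket₂ α β η)† ∘L (V : RTP βh α →L[ℂ] RTP α β) ∘L ket₂ βh α ξ = a}

/-- The closed span `[α α*]` of the operators `ξ ξ'*`. -/
def BaseModule.compacts {B Bd : NonUnitalStarSubalgebra ℂ (𝔎 →L[ℂ] 𝔎)} (α : BaseModule B Bd H) :
    Submodule ℂ (H →L[ℂ] H) :=
  cspan {a | ∃ ξ ∈ α.space, ∃ ξ' ∈ α.space, ξ ∘L (ξ')† = a}

/-- Regularity: `[⟨α|₁ V |α⟩₂] = [α α*]`. -/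
def IsRegular (V : RTP βh α ≃ₗᵢ[ℂ] RTP α β) : Prop :=
  cspan {a | ∃ ξ ξ' : α.space,
    (ket₁ α β ξ)† ∘L (V : RTP βh α →L[ℂ] RTP α β) ∘L ket₂ βh α ξ' = a} = α.compacts

end PMU

/-! ### `C*`-pseudo-Kac systems -/

/-- `(H, αh, βh, α, β)` is a `C*`-`(𝔟, 𝔟†, 𝔟, 𝔟†)`-module. -/
structure IsQuadModule (αh : BaseModule B Bd H) (βh : BaseModule Bd B H) (α : BaseModule B Bd H)
    (β : BaseModule Bd B H) : Prop where
  αh_βh : ActsOn αh βh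
  αh_α : ActsOn αh α
  αh_β : ActsOn αh β
  βh_αh : ActsOn βh αh
  βh_α : ActsOn βh α
  βh_β : ActsOn βh β
  α_αh : ActsOn α αh
  α_βh : ActsOn α βh
  α_β : ActsOn α β
  β_αh : ActsOn β αh
  β_βh : ActsOn β βh
  β_α : ActsOn β α

/-- Morphisms of `C*`-modules: `T α ⊆ γ` and `T* γ ⊆ α`. -/
def IsMorphism {B' Bd' : NonUnitalStarSubalgebra ℂ (𝔎 →L[ℂ] 𝔎)} (T : H →L[ℂ] K)
    (α : BaseModule B Bd H) (γ : BaseModule B' Bd' K) : Prop :=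
  (∀ ξ ∈ α.space, T ∘L ξ ∈ γ.space) ∧ ∀ η ∈ γ.space, (T)† ∘L η ∈ α.space

section Kac

open RTP

variable {αh : BaseModule B Bd H} {βh : BaseModule Bd B H} {α : BaseModule B Bd H}
  {β : BaseModule Bd B H}

namespace IsQuadModule

theorem tri (hm : IsQuadModule αh βh α β) : IsTriModule βh α β :=
  ⟨hm.βh_α, hm.βh_β, hm.α_βh, hm.α_β, hm.β_βh, hm.β_α⟩

theorem triCheck (hm : IsQuadModule αh βh α β) : IsTriModule αh βh α :=
  ⟨hm.αh_βh, hm.αh_α, hm.βh_αh, hm.βh_α, hm.α_αh, hm.α_βh⟩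

theorem triHat (hm : IsQuadModule αh βh α β) : IsTriModule α β αh :=
  ⟨hm.α_β, hm.α_αh, hm.β_α, hm.β_αh, hm.αh_α, hm.αh_β⟩

end IsQuadModule

variable (αh βh α β) in
/-- `U` is a symmetry (`U = U* = U⁻¹`) and a morphism from `(H, αh, βh)` to `(H, α, β)`. -/
structure IsSymmetry (U : H ≃ₗᵢ[ℂ] H) : Prop where
  involutive : ∀ x, U (U x) = x
  map_αh : IsMorphism (U : H →L[ℂ] H) αh α
  map_βh : IsMorphism (U : H →L[ℂ] H) βh β

namespace IsSymmetry

theorem intertwines_of_isMorphism {U : H ≃ₗᵢ[ℂ] H} (hU : ∀ x, U (U x) = x)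
    {B' Bd' : NonUnitalStarSubalgebra ℂ (𝔎 →L[ℂ] 𝔎)} {γ δ : BaseModule B' Bd' H}
    (h : IsMorphism (U : H →L[ℂ] H) γ δ) : Intertwines U γ δ ∧ Intertwines U δ γ := by
  have hadj : ((U : H →L[ℂ] H))† = (U : H →L[ℂ] H) := by
    refine ContinuousLinearMap.ext fun v => ext_inner_left ℂ fun w => ?_
    rw [ContinuousLinearMap.adjoint_inner_right]
    have := U.inner_map_map w (U v)
    rwa [hU] at this
  have hcomp : ∀ ξ : 𝔎 →L[ℂ] H, (U : H →L[ℂ] H) ∘L ((U : H →L[ℂ] H) ∘L ξ) = ξ := fun ξ => by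
    ext v
    exact hU _
  obtain ⟨h1, h2⟩ := h
  rw [hadj] at h2
  constructor
  · refine Set.Subset.antisymm ?_ fun y hy => ⟨_, h2 y hy, hcomp y⟩
    rintro _ ⟨x, hx, rfl⟩
    exact h1 x hx
  · refine Set.Subset.antisymm ?_ fun y hy => ⟨_, h1 y hy, hcomp y⟩
    rintro _ ⟨x, hx, rfl⟩
    exact h2 x hx

variable {U : H ≃ₗᵢ[ℂ] H}

theorem αh_α (hU : IsSymmetry αh βh α β U) : Intertwines U αh α :=
  (intertwines_of_isMorphism hU.involutive hU.map_αh).1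

theorem α_αh (hU : IsSymmetry αh βh α β U) : Intertwines U α αh :=
  (intertwines_of_isMorphism hU.involutive hU.map_αh).2

theorem βh_β (hU : IsSymmetry αh βh α β U) : Intertwines U βh β :=
  (intertwines_of_isMorphism hU.involutive hU.map_βh).1

theorem β_βh (hU : IsSymmetry αh βh α β U) : Intertwines U β βh :=
  (intertwines_of_isMorphism hU.involutive hU.map_βh).2

end IsSymmetry

/-- `V̌ = Σ (1 ⊗ U) V (1 ⊗ U) Σ : H_αh ⊗ {}_βh H → H_βh ⊗ {}_α H`. -/
def checkV {U : H ≃ₗᵢ[ℂ] H} (hU : IsSymmetry αh βh α β U) (V : RTP βh α ≃ₗᵢ[ℂ] RTP α β) :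
    RTP αh βh ≃ₗᵢ[ℂ] RTP βh α :=
  (flip αh βh).trans <| (mapRight βh U hU.αh_α).trans <| V.trans <|
    (mapRight α U hU.β_βh).trans <| flip α βh

/-- `V̂ = Σ (U ⊗ 1) V (U ⊗ 1) Σ : H_α ⊗ {}_β H → H_β ⊗ {}_αh H`. -/
def hatV {U : H ≃ₗᵢ[ℂ] H} (hU : IsSymmetry αh βh α β U) (V : RTP βh α ≃ₗᵢ[ℂ] RTP α β) :
    RTP α β ≃ₗᵢ[ℂ] RTP β αh :=
  (flip α β).trans <| (mapLeft U hU.β_βh α).trans <| V.trans <|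
    (mapLeft U hU.α_αh β).trans <| flip αh β

/-- `Σ (1 ⊗ U) V : H_βh ⊗ {}_α H → H_βh ⊗ {}_α H`. -/
def kacOp {U : H ≃ₗᵢ[ℂ] H} (hU : IsSymmetry αh βh α β U) (V : RTP βh α ≃ₗᵢ[ℂ] RTP α β) :
    RTP βh α ≃ₗᵢ[ℂ] RTP βh α :=
  V.trans <| (mapRight α U hU.β_βh).trans <| flip α βh

/-- `(V, U)` is a balanced `C*`-pseudo-multiplicative unitary. -/
structure IsBalancedPMU (hm : IsQuadModule αh βh α β) (V : RTP βh α ≃ₗᵢ[ℂ] RTP α β)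
    (U : H ≃ₗᵢ[ℂ] H) : Prop where
  symmetry : IsSymmetry αh βh α β U
  pmu : IsPMU hm.tri V
  pmu_check : IsPMU hm.triCheck (checkV symmetry V)
  pmu_hat : IsPMU hm.triHat (hatV symmetry V)

/-- `(V, U)` is a `C*`-pseudo-Kac system: a balanced `C*`-pseudo-multiplicative unitary such that
`V`, `V̌`, `V̂` are regular and `(Σ (1 ⊗ U) V)³ = 1`. -/
structure IsPseudoKacSystem (hm : IsQuadModule αh βh α β) (V : RTP βh α ≃ₗᵢ[ℂ] RTP α β)
    (U : H ≃ₗᵢ[ℂ] H) : Prop extends IsBalancedPMU hm V U where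
  regular : IsRegular V
  regular_check : IsRegular (checkV symmetry V)
  regular_hat : IsRegular (hatV symmetry V)
  cube : ∀ x, kacOp symmetry V (kacOp symmetry V (kacOp symmetry V x)) = x

end Kac

end Modules

end PseudoKac

end

/- Put `W = Σ(1 ⊗ U)V(1 ⊗ U)Σ`. The cube relation gives `⟨α|₁ V W |αh⟩₁ = U* ⟨α|₂ V* |α⟩₁ U*`, so
regularity of `V` yields `[⟨α|₁ V W |αh⟩₁] = [αh αh*]`. The pentagon equation for `W`, read as
`W₁₂* W₂₃ W₁₂ = W₁₃ W₂₃` and sliced between bras of the second leg and kets of the first, turns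
regularity of `W` into `[|βh⟩₁ Â] = [W |αh⟩₁ Â]`, where `Â` is the second leg of `V` and at the same
time the first leg of `W`. Hence `[A Â] = [⟨α|₁ V |βh⟩₁ Â] = [⟨α|₁ V W |αh⟩₁ Â] = [αh αh* Â]`, which
is `[αh αh*]` because `[Â* αh] = αh`. -/

noncomputable section

namespace PseudoKac

section ClosedSpan

variable {E F : Type*} [NormedAddCommGroup E] [NormedSpace ℂ E]
  [NormedAddCommGroup F] [NormedSpace ℂ F]

theorem cspan_mono {S T : Set E} (h : S ⊆ T) : cspan S ≤ cspan T :=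
  cspan_le (isClosed_cspan T) (h.trans (subset_cspan T))

theorem cspan_coe {C : Submodule ℂ E} (hC : IsClosed (C : Set E)) : cspan (C : Set E) = C :=
  le_antisymm (cspan_le hC subset_rfl) (subset_cspan (C : Set E))

theorem cspan_cspan (S : Set E) : cspan (cspan S : Set E) = cspan S :=
  cspan_coe (isClosed_cspan S)

theorem mem_cspan_preimage_val {M : Submodule ℂ E} {S : Set E} (hS : S ⊆ M) {x : M}
    (hx : (x : E) ∈ cspan S) : x ∈ cspan (Subtype.val ⁻¹' S : Set M) := by
  have image_preimage : M.subtype '' (Subtype.val ⁻¹' S : Set M) = S :=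
    (Subtype.image_preimage_coe (M : Set E) S).trans (Set.inter_eq_right.2 hS)
  have image_span : M.subtype '' (Submodule.span ℂ (Subtype.val ⁻¹' S) : Submodule ℂ M) =
      (Submodule.span ℂ S : Set E) := by
    rw [← Submodule.map_coe, Submodule.map_span, image_preimage]
  exact closure_subtype.2 (image_span.symm ▸ hx)

theorem cspan_image_preimage_congr {M : Submodule ℂ E} (g : M →L[ℂ] F) {S T : Set E}
    (hS : S ⊆ M) (hT : T ⊆ M) (h : cspan S = cspan T) :
    cspan (g '' (Subtype.val ⁻¹' S)) = cspan (g '' (Subtype.val ⁻¹' T)) := by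
  have image_le : ∀ {S T : Set E}, T ⊆ M → cspan S ≤ cspan T →
      cspan (g '' (Subtype.val ⁻¹' S)) ≤ cspan (g '' (Subtype.val ⁻¹' T)) := by
    intro S T hT hST
    refine cspan_le (isClosed_cspan _) ?_
    rintro _ ⟨x, hx, rfl⟩
    exact cspan_map_mem g (isClosed_cspan _)
      (fun y hy => subset_cspan _ (Set.mem_image_of_mem g hy)) x
      (mem_cspan_preimage_val hT (hST (subset_cspan S hx)))
  exact le_antisymm (image_le hT h.le) (image_le hS h.ge)

end ClosedSpan

/-- The set of products `f g` with `f ∈ S` and `g ∈ T`, written `S ⬝ T`; no span is taken. -/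
def opMul {E F G : Type*} [NormedAddCommGroup E] [NormedSpace ℂ E]
    [NormedAddCommGroup F] [NormedSpace ℂ F] [NormedAddCommGroup G] [NormedSpace ℂ G]
    (S : Set (F →L[ℂ] G)) (T : Set (E →L[ℂ] F)) :
    Set (E →L[ℂ] G) :=
  Set.image2 (fun f g => f ∘L g) S T

local notation:75 S:76 "⬝" T:75 => opMul S T

section OpMul

variable {E F G X : Type*} [NormedAddCommGroup E] [NormedSpace ℂ E]
  [NormedAddCommGroup F] [NormedSpace ℂ F] [NormedAddCommGroup G] [NormedSpace ℂ G]
  [NormedAddCommGroup X] [NormedSpace ℂ X]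

theorem opMul_assoc (R : Set (G →L[ℂ] X)) (S : Set (F →L[ℂ] G)) (T : Set (E →L[ℂ] F)) :
    (R ⬝ S) ⬝ T = R ⬝ S ⬝ T :=
  Set.image2_assoc fun _ _ _ => rfl

theorem cspan_opMul_left (S : Set (F →L[ℂ] G)) (T : Set (E →L[ℂ] F)) :
    cspan ((cspan S : Set (F →L[ℂ] G)) ⬝ T) = cspan (S ⬝ T) := by
  refine le_antisymm (cspan_le (isClosed_cspan _) ?_)
    (cspan_mono (Set.image2_subset_right (subset_cspan S)))
  rintro _ ⟨f, hf, g, hg, rfl⟩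
  exact cspan_map_mem ((ContinuousLinearMap.compL ℂ E F G).flip g) (isClosed_cspan _)
    (fun s hs => subset_cspan (S ⬝ T) ⟨s, hs, g, hg, rfl⟩) f hf

theorem cspan_opMul_right (S : Set (F →L[ℂ] G)) (T : Set (E →L[ℂ] F)) :
    cspan (S ⬝ (cspan T : Set (E →L[ℂ] F))) = cspan (S ⬝ T) := by
  refine le_antisymm (cspan_le (isClosed_cspan _) ?_)
    (cspan_mono (Set.image2_subset_left (subset_cspan T)))
  rintro _ ⟨f, hf, g, hg, rfl⟩
  exact cspan_map_mem (ContinuousLinearMap.compL ℂ E F G f) (isClosed_cspan _)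
    (fun s hs => subset_cspan (S ⬝ T) ⟨f, hf, s, hs, rfl⟩) g hg

theorem cspan_opMul_congr_left {S S' : Set (F →L[ℂ] G)} (h : cspan S = cspan S')
    (T : Set (E →L[ℂ] F)) : cspan (S ⬝ T) = cspan (S' ⬝ T) := by
  rw [← cspan_opMul_left, h, cspan_opMul_left]

theorem cspan_opMul_congr_right (S : Set (F →L[ℂ] G)) {T T' : Set (E →L[ℂ] F)}
    (h : cspan T = cspan T') : cspan (S ⬝ T) = cspan (S ⬝ T') := by
  rw [← cspan_opMul_right, h, cspan_opMul_right]

/-- A unitary as a set of operators with one element, so that it can be multiplied with sets. -/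
def single (W : E ≃ₗᵢ[ℂ] F) : Set (E →L[ℂ] F) :=
  {(W : E →L[ℂ] F)}

theorem single_opMul (W : F ≃ₗᵢ[ℂ] G) (S : Set (E →L[ℂ] F)) :
    single W ⬝ S = (fun f => (W : F →L[ℂ] G) ∘L f) '' S :=
  Set.image2_singleton_left

theorem single_opMul_range {ι : Type*} (W : F ≃ₗᵢ[ℂ] G) (f : ι → E →L[ℂ] F) :
    single W ⬝ Set.range f = Set.range fun i => (W : F →L[ℂ] G) ∘L f i :=
  (single_opMul W _).trans (Set.range_comp _ f).symm

theorem range_opMul_single {ι : Type*} (f : ι → F →L[ℂ] G) (W : E ≃ₗᵢ[ℂ] F) :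
    Set.range f ⬝ single W = Set.range fun i => f i ∘L (W : E →L[ℂ] F) :=
  Set.image2_singleton_right.trans (Set.range_comp _ f).symm

theorem single_trans (V : E ≃ₗᵢ[ℂ] F) (W : F ≃ₗᵢ[ℂ] G) :
    single (V.trans W) = single W ⬝ single V := by
  rw [single_opMul, single, single, Set.image_singleton]
  rfl

theorem single_symm_opMul_cancel (W : F ≃ₗᵢ[ℂ] G) (S : Set (E →L[ℂ] F)) :
    single W.symm ⬝ single W ⬝ S = S := by
  rw [← opMul_assoc, ← single_trans, W.self_trans_symm, single_opMul]
  exact Set.image_id S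

theorem opMul_single_cancel (S : Set (F →L[ℂ] G)) (W : E ≃ₗᵢ[ℂ] F) :
    S ⬝ single W ⬝ single W.symm = S := by
  rw [← single_trans, W.symm_trans_self, opMul, single, Set.image2_singleton_right]
  exact Set.image_id S

end OpMul

section Adjoint

variable {E F G : Type*} [NormedAddCommGroup E] [InnerProductSpace ℂ E] [CompleteSpace E]
  [NormedAddCommGroup F] [InnerProductSpace ℂ F] [CompleteSpace F]
  [NormedAddCommGroup G] [InnerProductSpace ℂ G] [CompleteSpace G]

/-- The set of adjoints of the elements of `S`, the paper's `S*`. -/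
def opAdj (S : Set (E →L[ℂ] F)) : Set (F →L[ℂ] E) :=
  (fun f => (f)†) '' S

theorem opAdj_opAdj (S : Set (E →L[ℂ] F)) : opAdj (opAdj S) = S := by
  simp [opAdj, Set.image_image]

theorem opAdj_opMul (S : Set (F →L[ℂ] G)) (T : Set (E →L[ℂ] F)) :
    opAdj (S ⬝ T) = opAdj T ⬝ opAdj S :=
  Set.image_image2_antidistrib fun f g => ContinuousLinearMap.adjoint_comp f g

theorem opAdj_single (W : E ≃ₗᵢ[ℂ] F) : opAdj (single W) = single W.symm :=
  Set.image_singleton.trans (congrArg _ W.adjoint_eq_symm)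

theorem adjoint_mem_cspan {S : Set (E →L[ℂ] F)} {x : E →L[ℂ] F} (hx : x ∈ cspan S) :
    (x)† ∈ cspan (opAdj S) := by
  let C : Submodule ℂ (E →L[ℂ] F) := (cspan (opAdj S)).comap
    ((ContinuousLinearMap.adjoint : (E →L[ℂ] F) ≃ₗᵢ⋆[ℂ] (F →L[ℂ] E)).toLinearEquiv :
      (E →L[ℂ] F) →ₗ⋆[ℂ] (F →L[ℂ] E))
  have hC : IsClosed (C : Set (E →L[ℂ] F)) := (isClosed_cspan (opAdj S)).preimage
    (ContinuousLinearMap.adjoint : (E →L[ℂ] F) ≃ₗᵢ⋆[ℂ] (F →L[ℂ] E)).continuous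
  exact cspan_le hC (fun s hs => subset_cspan (opAdj S) ⟨s, hs, rfl⟩) hx

theorem cspan_opAdj_congr {S T : Set (E →L[ℂ] F)} (h : cspan S = cspan T) :
    cspan (opAdj S) = cspan (opAdj T) := by
  have opAdj_le : ∀ {S T : Set (E →L[ℂ] F)}, cspan S ≤ cspan T →
      cspan (opAdj S) ≤ cspan (opAdj T) := by
    intro S T hST
    refine cspan_le (isClosed_cspan _) ?_
    rintro _ ⟨s, hs, rfl⟩
    exact adjoint_mem_cspan (hST (subset_cspan S hs))
  exact le_antisymm (opAdj_le h.le) (opAdj_le h.ge)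

end Adjoint

section Modules

variable {𝔎 H K L : Type*} [NormedAddCommGroup 𝔎] [InnerProductSpace ℂ 𝔎] [CompleteSpace 𝔎]
  [NormedAddCommGroup H] [InnerProductSpace ℂ H] [CompleteSpace H]
  [NormedAddCommGroup K] [InnerProductSpace ℂ K] [CompleteSpace K]
  [NormedAddCommGroup L] [InnerProductSpace ℂ L] [CompleteSpace L]
  {B Bd B₂ Bd₂ : NonUnitalStarSubalgebra ℂ (𝔎 →L[ℂ] 𝔎)}

namespace BaseModule

variable (α : BaseModule B Bd H)

theorem inner_rho_star_vec (c : Bd) {ξ ξ' : 𝔎 →L[ℂ] H} (hξ : ξ ∈ α.space) (hξ' : ξ' ∈ α.space)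
    (ζ ζ' : 𝔎) : ⟪α.rho (star c) (ξ ζ), ξ' ζ'⟫_ℂ = ⟪ξ ζ, α.rho c (ξ' ζ')⟫_ℂ := by
  have gram_comm : ((ξ)†) (ξ' ((c : 𝔎 →L[ℂ] 𝔎) ζ')) = (c : 𝔎 →L[ℂ] 𝔎) (((ξ)†) (ξ' ζ')) :=
    congrArg (fun T : 𝔎 →L[ℂ] 𝔎 => T ζ') (α.isBase.commute _ (α.gram_mem hξ hξ') _ c.2).eq
  rw [α.rho_apply _ hξ, α.rho_apply _ hξ', ← ContinuousLinearMap.adjoint_inner_right ξ,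
    ← ContinuousLinearMap.adjoint_inner_right ξ, gram_comm]
  exact ContinuousLinearMap.adjoint_inner_left _ _ _

theorem adjoint_rho (c : Bd) : (α.rho c)† = α.rho (star c) := by
  refine ((ContinuousLinearMap.eq_adjoint_iff _ _).2 fun v w => ?_).symm
  have inner_vec_left : ∀ ξ ∈ α.space, ∀ ζ,
      ⟪α.rho (star c) (ξ ζ), w⟫_ℂ = ⟪ξ ζ, α.rho c w⟫_ℂ := by
    intro ξ hξ ζ
    have functional_eq : innerSL ℂ (α.rho (star c) (ξ ζ)) = innerSL ℂ (ξ ζ) ∘L α.rho c :=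
      α.ext_vec fun ξ' hξ' ζ' => α.inner_rho_star_vec c hξ hξ' ζ ζ'
    exact congrArg (fun f : H →L[ℂ] ℂ => f w) functional_eq
  have functional_eq : innerSL ℂ w ∘L α.rho (star c) = innerSL ℂ (α.rho c w) :=
    α.ext_vec fun ξ hξ ζ => by
      simpa only [ContinuousLinearMap.comp_apply, innerSL_apply_apply, inner_conj_symm] using
        congrArg conj (inner_vec_left ξ hξ ζ)
  simpa only [ContinuousLinearMap.comp_apply, innerSL_apply_apply, inner_conj_symm] using
    congrArg conj (congrArg (fun f : H →L[ℂ] ℂ => f v) functional_eq)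

theorem adjoint_rho_star (c : Bd) : (α.rho (star c))† = α.rho c := by
  rw [adjoint_rho, star_star]

end BaseModule

/-- The space of bounded operators that intertwine the representations `ρ_α` and `ρ_γ`; these are
the operators `T` for which `T ⊗ 1` exists on relative tensor products. -/
def intertwiners (α : BaseModule B Bd H) (γ : BaseModule B Bd K) : Submodule ℂ (H →L[ℂ] K) where
  carrier := {T | ∀ (c : Bd) (v : H), T (α.rho c v) = γ.rho c (T v)}
  zero_mem' c v := by simp
  add_mem' hS hT c v := by simp [hS c v, hT c v]
  smul_mem' r T hT c v := by simp [hT c v]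

section Intertwiners

variable {α : BaseModule B Bd H} {γ : BaseModule B Bd K} {δ : BaseModule B Bd L}

theorem adjoint_mem_intertwiners {T : H →L[ℂ] K} (hT : T ∈ intertwiners α γ) :
    (T)† ∈ intertwiners γ α := by
  intro c v
  refine ext_inner_left ℂ fun w => ?_
  rw [ContinuousLinearMap.adjoint_inner_right, ← γ.adjoint_rho_star, ← α.adjoint_rho_star,
    ContinuousLinearMap.adjoint_inner_right, ContinuousLinearMap.adjoint_inner_right,
    ContinuousLinearMap.adjoint_inner_right, hT]

theorem comp_mem_intertwiners {S : K →L[ℂ] L} {T : H →L[ℂ] K} (hS : S ∈ intertwiners γ δ)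
    (hT : T ∈ intertwiners α γ) : S ∘L T ∈ intertwiners α δ := fun c v => by
  simp only [ContinuousLinearMap.comp_apply]
  rw [hT, hS]

theorem opAdj_subset_intertwiners {S : Set (H →L[ℂ] K)}
    (hS : S ⊆ intertwiners α γ) : opAdj S ⊆ intertwiners γ α := by
  rintro _ ⟨T, hT, rfl⟩
  exact adjoint_mem_intertwiners (hS hT)

theorem opMul_subset_intertwiners {S : Set (K →L[ℂ] L)} {T : Set (H →L[ℂ] K)}
    (hS : S ⊆ intertwiners γ δ) (hT : T ⊆ intertwiners α γ) : S ⬝ T ⊆ intertwiners α δ := by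
  rintro _ ⟨s, hs, t, ht, rfl⟩
  exact comp_mem_intertwiners (hS hs) (hT ht)

theorem exists_intertwiner_inner_eq {T : H →L[ℂ] K} (hT : T ∈ intertwiners α γ) :
    ∃ R ∈ intertwiners α α, ∀ v w : H,
      ⟪R v, R w⟫_ℂ = ((‖T‖ : ℝ) : ℂ) ^ 2 * ⟪v, w⟫_ℂ - ⟪T v, T w⟫_ℂ := by
  obtain ⟨D, hD⟩ := exists_defect T
  have defect_nonneg : 0 ≤ (D)† ∘L D :=
    (ContinuousLinearMap.nonneg_iff_isPositive _).2
      (ContinuousLinearMap.isPositive_adjoint_comp_self D)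
  obtain ⟨R, R_adjoint, R_sq, R_commute⟩ := exists_sqrt defect_nonneg
  refine ⟨R, fun c v => ?_, fun v w => ?_⟩
  · have defect_commute : Commute ((D)† ∘L D) (α.rho c) := ContinuousLinearMap.ext fun v => by
      have := comp_mem_intertwiners (adjoint_mem_intertwiners hT) hT c v
      simp only [ContinuousLinearMap.comp_apply] at this
      simp [hD, mul_apply_eq_comp, this]
    exact congrArg (fun S : H →L[ℂ] H => S v) (R_commute _ defect_commute).eq
  · nth_rewrite 1 [← R_adjoint]
    rw [ContinuousLinearMap.adjoint_inner_left, ← mul_apply_eq_comp, R_sq, hD]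
    simp [inner_sub_right, inner_smul_right, ContinuousLinearMap.adjoint_inner_right]

theorem BaseModule.opMul_opAdj_subset_intertwiners (α : BaseModule B Bd H) :
    (α.space : Set (𝔎 →L[ℂ] H)) ⬝ opAdj α.space ⊆
      (intertwiners α α : Set (H →L[ℂ] H)) := by
  rintro _ ⟨x, hx, _, ⟨y, hy, rfl⟩, rfl⟩ c v
  have rho_star_comp : α.rho (star c) ∘L y = y ∘L (c : 𝔎 →L[ℂ] 𝔎)† :=
    ContinuousLinearMap.ext fun ζ => α.rho_apply _ hy ζ
  have adjoint_comp_rho : (y)† ∘L α.rho c = (c : 𝔎 →L[ℂ] 𝔎) ∘L (y)† := by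
    simpa only [ContinuousLinearMap.adjoint_comp, α.adjoint_rho, star_star,
      ContinuousLinearMap.adjoint_adjoint] using congrArg (fun T => (T)†) rho_star_comp
  have := congrArg (fun T : H →L[ℂ] 𝔎 => x (T v)) adjoint_comp_rho
  simp only [ContinuousLinearMap.comp_apply] at this ⊢
  rw [this, α.rho_apply c hx]

end Intertwiners

namespace Intertwines

variable {W : H ≃ₗᵢ[ℂ] K}

theorem mem_intertwiners {α : BaseModule B Bd H} {γ : BaseModule B Bd K}
    (h : Intertwines W α γ) : (W : H →L[ℂ] K) ∈ intertwiners α γ := by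
  intro c v
  have comp_rho : (W : H →L[ℂ] K) ∘L α.rho c = γ.rho c ∘L (W : H →L[ℂ] K) :=
    α.ext_vec fun ξ hξ ζ => by
      have := γ.rho_apply c (h.mem ⟨ξ, hξ⟩) ζ
      simp only [ContinuousLinearMap.comp_apply] at this ⊢
      rw [this, α.rho_apply c hξ]
  exact congrArg (fun T : H →L[ℂ] K => T v) comp_rho

theorem single_subset_intertwiners {α : BaseModule B Bd H} {γ : BaseModule B Bd K}
    (h : Intertwines W α γ) : single W ⊆ (intertwiners α γ : Set (H →L[ℂ] K)) :=
  Set.singleton_subset_iff.2 h.mem_intertwiners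

theorem single_symm_subset_intertwiners {α : BaseModule B Bd H} {γ : BaseModule B Bd K}
    (h : Intertwines W α γ) : single W.symm ⊆ (intertwiners γ α : Set (K →L[ℂ] H)) :=
  opAdj_single W ▸ opAdj_subset_intertwiners h.single_subset_intertwiners

variable {α : BaseModule B Bd H} {γ : BaseModule B₂ Bd₂ K}

theorem single_opMul (h : Intertwines W α γ) :
    single W ⬝ (α.space : Set (𝔎 →L[ℂ] H)) = γ.space :=
  Set.image2_singleton_left.trans h

theorem single_symm_opMul (h : Intertwines W α γ) :
    single W.symm ⬝ (γ.space : Set (𝔎 →L[ℂ] K)) = α.space := by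
  rw [← h.single_opMul, single_symm_opMul_cancel]

theorem surjective {α : BaseModule B Bd H} {γ : BaseModule B Bd K} (h : Intertwines W α γ) :
    Function.Surjective fun ξ : α.space => (⟨(W : H →L[ℂ] K) ∘L ξ, h.mem ξ⟩ : γ.space) := by
  rintro ⟨_, hη⟩
  obtain ⟨ξ, hξ, rfl⟩ := (Set.ext_iff.1 h _).2 hη
  exact ⟨⟨ξ, hξ⟩, rfl⟩

end Intertwines

namespace RTP

/-- The set `|β⟩₁` of operators `K → H β⊗γ K`. -/
def kets₁ (β : BaseModule B Bd H) (γ : BaseModule Bd B K) : Set (K →L[ℂ] RTP β γ) :=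
  Set.range (ket₁ β γ)

/-- The set `|γ⟩₂` of operators `H → H β⊗γ K`. -/
def kets₂ (β : BaseModule B Bd H) (γ : BaseModule Bd B K) : Set (H →L[ℂ] RTP β γ) :=
  Set.range (ket₂ β γ)

/-- The set `⟨β|₁` of operators `H β⊗γ K → K`. -/
def bras₁ (β : BaseModule B Bd H) (γ : BaseModule Bd B K) : Set (RTP β γ →L[ℂ] K) :=
  opAdj (kets₁ β γ)

/-- The set `⟨γ|₂` of operators `H β⊗γ K → H`. -/
def bras₂ (β : BaseModule B Bd H) (γ : BaseModule Bd B K) : Set (RTP β γ →L[ℂ] H) :=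
  opAdj (kets₂ β γ)

section Ext

variable {β : BaseModule B Bd H} {γ : BaseModule Bd B K}

theorem ext_ket₂ {F : Type*} [NormedAddCommGroup F] [NormedSpace ℂ F]
    {S T : RTP β γ →L[ℂ] F} (h : ∀ η v, S (ket₂ β γ η v) = T (ket₂ β γ η v)) : S = T :=
  ext_of_cspan_eq_top (cspan_tmul β γ) fun p =>
    ket₂_apply β γ p.2.2 p.1 p.2.1 ▸ h p.2.2 ((p.1 : 𝔎 →L[ℂ] H) p.2.1)

theorem ext_ket₁ {F : Type*} [NormedAddCommGroup F] [NormedSpace ℂ F]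
    {S T : RTP β γ →L[ℂ] F} (h : ∀ ξ v, S (ket₁ β γ ξ v) = T (ket₁ β γ ξ v)) : S = T :=
  ext_of_cspan_eq_top (cspan_tmul β γ) fun p =>
    ket₁_apply β γ p.1 p.2.2 p.2.1 ▸ h p.1 ((p.2.2 : 𝔎 →L[ℂ] K) p.2.1)

theorem ext_inner_ket₂ {x y : RTP β γ}
    (h : ∀ η v, ⟪ket₂ β γ η v, x⟫_ℂ = ⟪ket₂ β γ η v, y⟫_ℂ) : x = y := by
  refine (innerSL_inj (𝕜 := ℂ)).1 (ext_ket₂ fun η v => ?_)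
  simpa only [innerSL_apply_apply, inner_conj_symm] using congrArg conj (h η v)

end Ext

section Kets

variable (β : BaseModule B Bd H) (γ : BaseModule Bd B K)

theorem ket₁_apply_eq_ket₂_apply (ξ : β.space) (η : γ.space) (ζ : 𝔎) :
    ket₁ β γ ξ ((η : 𝔎 →L[ℂ] K) ζ) = ket₂ β γ η ((ξ : 𝔎 →L[ℂ] H) ζ) :=
  (ket₁_apply β γ ξ η ζ).trans (ket₂_apply β γ η ξ ζ).symm

theorem norm_ket₁_le (ξ : β.space) : ‖ket₁ β γ ξ‖ ≤ ‖(ξ : 𝔎 →L[ℂ] H)‖ :=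
  calc ‖ket₁ β γ ξ‖ ≤ ‖(RTP.flip γ β : RTP γ β →L[ℂ] RTP β γ)‖ * ‖ket₂ γ β ξ‖ :=
        ContinuousLinearMap.opNorm_comp_le _ _
    _ ≤ ‖ket₂ γ β ξ‖ := mul_le_of_le_one_left (norm_nonneg _)
        (RTP.flip γ β).toLinearIsometry.norm_toContinuousLinearMap_le
    _ ≤ ‖(ξ : 𝔎 →L[ℂ] H)‖ := norm_gramMap_le γ.cspan_vec (norm_nonneg _) (ket_kernel γ β ξ)

/-- `ξ ↦ |ξ⟩₁` as a bounded linear map. -/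
def ket₁L : β.space →L[ℂ] (K →L[ℂ] RTP β γ) :=
  LinearMap.mkContinuous
    { toFun := ket₁ β γ
      map_add' := fun ξ ξ' => γ.ext_vec fun η hη ζ => by
        have ket₁_eq := fun ξ => ket₁_apply_eq_ket₂_apply β γ ξ ⟨η, hη⟩ ζ
        simp only at ket₁_eq
        simp [ket₁_eq]
      map_smul' := fun r ξ => γ.ext_vec fun η hη ζ => by
        have ket₁_eq := fun ξ => ket₁_apply_eq_ket₂_apply β γ ξ ⟨η, hη⟩ ζ
        simp only at ket₁_eq
        simp [ket₁_eq] } 1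
    fun ξ => (norm_ket₁_le β γ ξ).trans_eq (one_mul _).symm

theorem cspan_kets₁_eq_of_cspan_eq {S : Set (𝔎 →L[ℂ] H)} (hS : cspan S = β.space) :
    cspan (kets₁ β γ) = cspan (ket₁L β γ '' (Subtype.val ⁻¹' S)) := by
  have kets₁_eq : kets₁ β γ = ket₁L β γ '' (Subtype.val ⁻¹' (β.space : Set (𝔎 →L[ℂ] H))) := by
    rw [Subtype.coe_preimage_self, Set.image_univ]
    rfl
  rw [kets₁_eq]
  exact cspan_image_preimage_congr _ subset_rfl (hS ▸ subset_cspan S)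
    ((cspan_coe β.isClosed).trans hS.symm)

theorem single_flip_opMul_kets₂ : single (RTP.flip β γ) ⬝ kets₂ β γ = kets₁ γ β :=
  single_opMul_range _ _

theorem flip_symm : (RTP.flip β γ).symm = RTP.flip γ β :=
  LinearIsometryEquiv.ext fun v => (LinearIsometryEquiv.symm_apply_eq _).2 (flip_flip γ β v).symm

theorem single_flip_opMul_kets₁ : single (RTP.flip β γ) ⬝ kets₁ β γ = kets₂ γ β := by
  rw [← single_flip_opMul_kets₂ γ β, ← flip_symm γ β, single_symm_opMul_cancel]

theorem bras₁_opMul_single_flip : bras₁ γ β ⬝ single (RTP.flip β γ) = bras₂ β γ := by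
  rw [bras₁, bras₂, ← single_flip_opMul_kets₁, opAdj_opMul, opAdj_single, flip_symm]

theorem bras₂_opMul_single_flip : bras₂ γ β ⬝ single (RTP.flip β γ) = bras₁ β γ := by
  rw [bras₁, bras₂, ← single_flip_opMul_kets₂, opAdj_opMul, opAdj_single, flip_symm]

variable {β γ}

theorem adjoint_ket₂_comp_ket₁ (ξ : β.space) (η : γ.space) :
    (ket₂ β γ η)† ∘L ket₁ β γ ξ = (ξ : 𝔎 →L[ℂ] H) ∘L (η : 𝔎 →L[ℂ] K)† :=
  γ.ext_vec fun η' hη' ζ => by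
    have gram := DFunLike.congr_fun (adjoint_ket₂_comp β γ η ⟨η', hη'⟩) ((ξ : 𝔎 →L[ℂ] H) ζ)
    have ket₁_eq := ket₁_apply_eq_ket₂_apply β γ ξ ⟨η', hη'⟩ ζ
    simp only [ContinuousLinearMap.comp_apply] at gram ket₁_eq ⊢
    rw [ket₁_eq, gram, β.rho_apply _ ξ.2]
    rfl

theorem adjoint_ket₁_comp_ket₂ (ξ : β.space) (η : γ.space) :
    (ket₁ β γ ξ)† ∘L ket₂ β γ η = (η : 𝔎 →L[ℂ] K) ∘L (ξ : 𝔎 →L[ℂ] H)† := by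
  simpa only [ContinuousLinearMap.adjoint_comp, ContinuousLinearMap.adjoint_adjoint] using
    congrArg (fun T => (T)†) (adjoint_ket₂_comp_ket₁ ξ η)

theorem cspan_bras₁_kets₁_opMul {δ : BaseModule B₂ Bd₂ K} (h : ActsOn γ δ) :
    cspan (bras₁ β γ ⬝ kets₁ β γ ⬝ (δ.space : Set (𝔎 →L[ℂ] K))) = δ.space := by
  refine le_antisymm (cspan_le δ.isClosed ?_) ?_
  · rintro _ ⟨_, ⟨_, ⟨ξ, rfl⟩, rfl⟩, _, ⟨_, ⟨ξ', rfl⟩, η, hη, rfl⟩, rfl⟩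
    have := h.mem ⟨_, β.gram_mem ξ.2 ξ'.2⟩ hη
    rwa [← adjoint_ket₁_comp β γ ξ ξ'] at this
  · conv_lhs => rw [← h]
    refine cspan_le (isClosed_cspan _) ?_
    rintro _ ⟨c, η, hη, rfl⟩
    refine γ.rho_mem_of_span β.span_gram ((ContinuousLinearMap.compL ℂ 𝔎 K K).flip η)
      (isClosed_cspan _) ?_ c
    rintro ⟨_, hc⟩ ⟨ξ, hξ, ξ', hξ', rfl⟩
    refine subset_cspan (bras₁ β γ ⬝ _)
      ⟨_, ⟨_, ⟨⟨ξ, hξ⟩, rfl⟩, rfl⟩, _, ⟨_, ⟨⟨ξ', hξ'⟩, rfl⟩, η, hη, rfl⟩, ?_⟩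
    exact congrArg (fun T : K →L[ℂ] K => T ∘L η) (adjoint_ket₁_comp β γ ⟨ξ, hξ⟩ ⟨ξ', hξ'⟩)

end Kets

section TensorLeft

variable {M : Type*} [NormedAddCommGroup M] [InnerProductSpace ℂ M] [CompleteSpace M]
  {α : BaseModule B Bd H} {α' : BaseModule B Bd K} {α'' : BaseModule B Bd L}
  (γ : BaseModule Bd B M)

theorem cspan_range_ket₂ (α : BaseModule B Bd H) :
    cspan (Set.range fun p : γ.space × H => ket₂ α γ p.1 p.2) = ⊤ := by
  refine eq_top_iff.2 ((cspan_ket₂ α γ).ge.trans (cspan_mono ?_))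
  rintro _ ⟨_, ⟨η, rfl⟩, v, rfl⟩
  exact ⟨(η, v), rfl⟩

theorem kerNonneg_of_mem_intertwiners {T : H →L[ℂ] K} (hT : T ∈ intertwiners α α') :
    KerNonneg fun i j : γ.space × H => ((‖T‖ : ℝ) : ℂ) ^ 2 *
      ⟪ket₂ α γ i.1 i.2, ket₂ α γ j.1 j.2⟫_ℂ -
      ⟪ket₂ α' γ i.1 (T i.2), ket₂ α' γ j.1 (T j.2)⟫_ℂ := by
  obtain ⟨R, hR, inner_R⟩ := exists_intertwiner_inner_eq hT
  intro f
  have gram_eq : (fun i j : γ.space × H => ((‖T‖ : ℝ) : ℂ) ^ 2 *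
      ⟪ket₂ α γ i.1 i.2, ket₂ α γ j.1 j.2⟫_ℂ -
      ⟪ket₂ α' γ i.1 (T i.2), ket₂ α' γ j.1 (T j.2)⟫_ℂ) =
      fun i j => ⟪ket₂ α γ i.1 (R i.2), ket₂ α γ j.1 (R j.2)⟫_ℂ := by
    funext i j
    rw [inner_ket₂, inner_ket₂, inner_ket₂, ← hT, ← hR, inner_R]
  rw [gram_eq, ← inner_linearCombination]
  exact inner_self_nonneg (𝕜 := ℂ)

/-- The operator `T ⊗ 1 : |η⟩₂ v ↦ |η⟩₂ (T v)`, as a bounded linear map in the intertwiner `T`. -/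
def tensorLeft (α : BaseModule B Bd H) (α' : BaseModule B Bd K) :
    intertwiners α α' →L[ℂ] (RTP α γ →L[ℂ] RTP α' γ) :=
  have map_ket₂ : ∀ (T : intertwiners α α') (p : γ.space × H),
      gramMap (fun p : γ.space × H => ket₂ α γ p.1 p.2)
          (fun p => ket₂ α' γ p.1 ((T : H →L[ℂ] K) p.2)) (ket₂ α γ p.1 p.2) =
        ket₂ α' γ p.1 ((T : H →L[ℂ] K) p.2) := fun T p =>
    gramMap_apply (cspan_range_ket₂ γ α) (norm_nonneg _) (kerNonneg_of_mem_intertwiners γ T.2) p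
  LinearMap.mkContinuous
    { toFun := fun T => gramMap (fun p : γ.space × H => ket₂ α γ p.1 p.2)
        fun p => ket₂ α' γ p.1 ((T : H →L[ℂ] K) p.2)
      map_add' := fun S T => ext_of_cspan_eq_top (cspan_range_ket₂ γ α) fun p => by
        have map_add_ket₂ := map_ket₂ (S + T) p
        rw [add_apply, map_ket₂ S p, map_ket₂ T p]
        exact map_add_ket₂.trans (map_add (ket₂ α' γ p.1) _ _)
      map_smul' := fun r T => ext_of_cspan_eq_top (cspan_range_ket₂ γ α) fun p => by
        have map_smul_ket₂ := map_ket₂ (r • T) p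
        rw [smul_apply, map_ket₂ T p]
        exact map_smul_ket₂.trans (map_smul (ket₂ α' γ p.1) _ _) } 1
    fun T => (norm_gramMap_le (cspan_range_ket₂ γ α) (norm_nonneg _)
      (kerNonneg_of_mem_intertwiners γ T.2)).trans_eq (one_mul _).symm

theorem tensorLeft_ket₂ (T : intertwiners α α') (η : γ.space) (v : H) :
    tensorLeft γ α α' T (ket₂ α γ η v) = ket₂ α' γ η ((T : H →L[ℂ] K) v) :=
  gramMap_apply (cspan_range_ket₂ γ α) (norm_nonneg _) (kerNonneg_of_mem_intertwiners γ T.2) (η, v)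

theorem tensorLeft_comp (S : intertwiners α' α'') (T : intertwiners α α') :
    tensorLeft γ α' α'' S ∘L tensorLeft γ α α' T =
      tensorLeft γ α α'' ⟨_, comp_mem_intertwiners S.2 T.2⟩ :=
  ext_ket₂ fun η v => by
    rw [ContinuousLinearMap.comp_apply, tensorLeft_ket₂, tensorLeft_ket₂, tensorLeft_ket₂]
    rfl

theorem adjoint_tensorLeft (T : intertwiners α α') :
    (tensorLeft γ α α' T)† = tensorLeft γ α' α ⟨_, adjoint_mem_intertwiners T.2⟩ :=
  ext_ket₂ fun η v => ext_inner_ket₂ fun η' w => by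
    rw [ContinuousLinearMap.adjoint_inner_right, tensorLeft_ket₂, tensorLeft_ket₂, inner_ket₂,
      inner_ket₂, ← adjoint_mem_intertwiners T.2, ContinuousLinearMap.adjoint_inner_right]

theorem ket₁_comp_adjoint_ket₁ (x y : α.space)
    (h : (x : 𝔎 →L[ℂ] H) ∘L (y : 𝔎 →L[ℂ] H)† ∈ intertwiners α α) :
    ket₁ α γ x ∘L (ket₁ α γ y)† = tensorLeft γ α α ⟨_, h⟩ :=
  ext_ket₂ fun η v => by
    have bra_ket := DFunLike.congr_fun (adjoint_ket₁_comp_ket₂ (γ := γ) y η) v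
    simp only [ContinuousLinearMap.comp_apply] at bra_ket
    rw [tensorLeft_ket₂, ContinuousLinearMap.comp_apply, bra_ket]
    exact ket₁_apply_eq_ket₂_apply α γ x η _

section MapLeft

variable {W : H ≃ₗᵢ[ℂ] K} (hW : Intertwines W α α')

theorem mapLeft_comp_ket₁ (ξ : α.space) :
    (mapLeft W hW γ : RTP α γ →L[ℂ] RTP α' γ) ∘L ket₁ α γ ξ = ket₁ α' γ ⟨_, hW.mem ξ⟩ :=
  γ.ext_vec fun η hη ζ =>
    (congrArg (mapLeft W hW γ) (ket₁_apply α γ ξ ⟨η, hη⟩ ζ)).trans <|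
      (mapLeft_tmul W hW γ _).trans (ket₁_apply α' γ ⟨_, hW.mem ξ⟩ ⟨η, hη⟩ ζ).symm

theorem mapLeft_comp_ket₂ (η : γ.space) :
    (mapLeft W hW γ : RTP α γ →L[ℂ] RTP α' γ) ∘L ket₂ α γ η =
      ket₂ α' γ η ∘L (W : H →L[ℂ] K) :=
  α.ext_vec fun ξ hξ ζ =>
    (congrArg (mapLeft W hW γ) (ket₂_apply α γ η ⟨ξ, hξ⟩ ζ)).trans <|
      (mapLeft_tmul W hW γ _).trans (ket₂_apply α' γ η ⟨_, hW.mem ⟨ξ, hξ⟩⟩ ζ).symm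

theorem tensorLeft_coe_eq_mapLeft :
    tensorLeft γ α α' ⟨W, hW.mem_intertwiners⟩ = mapLeft W hW γ :=
  ext_ket₂ fun η v =>
    (tensorLeft_ket₂ γ _ η v).trans (DFunLike.congr_fun (mapLeft_comp_ket₂ γ hW η) v).symm

theorem single_mapLeft_opMul_kets₁ : single (mapLeft W hW γ) ⬝ kets₁ α γ = kets₁ α' γ := by
  rw [kets₁, single_opMul_range]
  simp only [mapLeft_comp_ket₁]
  exact hW.surjective.range_comp (ket₁ α' γ)

theorem single_mapLeft_opMul_kets₂ :
    single (mapLeft W hW γ) ⬝ kets₂ α γ = kets₂ α' γ ⬝ single W := by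
  rw [kets₂, kets₂, single_opMul_range, range_opMul_single]
  simp only [mapLeft_comp_ket₂]

end MapLeft

section MapRight

variable (β : BaseModule Bd B M) {W : H ≃ₗᵢ[ℂ] K} (hW : Intertwines W α α')

theorem single_mapRight :
    single (mapRight β W hW) =
      single (RTP.flip α' β) ⬝ single (mapLeft W hW β) ⬝ single (RTP.flip β α) := by
  rw [mapRight, single_trans, single_trans]

theorem single_mapRight_opMul_kets₁ :
    single (mapRight β W hW) ⬝ kets₁ β α = kets₁ β α' ⬝ single W := by
  rw [single_mapRight, opMul_assoc, opMul_assoc, single_flip_opMul_kets₁,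
    single_mapLeft_opMul_kets₂, ← opMul_assoc, single_flip_opMul_kets₂]

theorem single_mapRight_opMul_kets₂ :
    single (mapRight β W hW) ⬝ kets₂ β α = kets₂ β α' := by
  rw [single_mapRight, opMul_assoc, opMul_assoc, single_flip_opMul_kets₂,
    single_mapLeft_opMul_kets₁, single_flip_opMul_kets₁]

theorem bras₂_opMul_single_mapRight :
    bras₂ β α' ⬝ single (mapRight β W hW) = bras₂ β α := by
  rw [bras₂, bras₂, ← single_symm_opMul_cancel (mapRight β W hW) (kets₂ β α),
    single_mapRight_opMul_kets₂, opAdj_opMul, opAdj_single, LinearIsometryEquiv.symm_symm]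

end MapRight

end TensorLeft

section Amplify

variable {M : Type*} [NormedAddCommGroup M] [InnerProductSpace ℂ M] [CompleteSpace M]
  {α : BaseModule B Bd H} {α' : BaseModule B Bd K} {α'' : BaseModule B Bd L}
  (γ : BaseModule Bd B M)

/-- The set `S ⊗ 1` of operators `T ⊗ 1` with `T ∈ S`; elements of `S` that are not intertwiners are
discarded. -/
def amplify (α : BaseModule B Bd H) (α' : BaseModule B Bd K) (S : Set (H →L[ℂ] K)) :
    Set (RTP α γ →L[ℂ] RTP α' γ) :=
  tensorLeft γ α α' '' (Subtype.val ⁻¹' S)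

theorem amplify_range {ι : Type*} {f : ι → H →L[ℂ] K} (hf : ∀ i, f i ∈ intertwiners α α') :
    amplify γ α α' (Set.range f) = Set.range fun i => tensorLeft γ α α' ⟨f i, hf i⟩ := by
  ext T
  constructor
  · rintro ⟨⟨_, _⟩, ⟨i, rfl⟩, rfl⟩
    exact ⟨i, rfl⟩
  · rintro ⟨i, rfl⟩
    exact ⟨⟨f i, hf i⟩, ⟨i, rfl⟩, rfl⟩

theorem amplify_opMul {S : Set (K →L[ℂ] L)} {T : Set (H →L[ℂ] K)}
    (hS : S ⊆ intertwiners α' α'') (hT : T ⊆ intertwiners α α') :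
    amplify γ α α'' (S ⬝ T) = amplify γ α' α'' S ⬝ amplify γ α α' T := by
  ext X
  constructor
  · rintro ⟨⟨_, _⟩, ⟨s, hs, t, ht, rfl⟩, rfl⟩
    exact ⟨_, ⟨⟨s, hS hs⟩, hs, rfl⟩, _, ⟨⟨t, hT ht⟩, ht, rfl⟩, tensorLeft_comp γ _ _⟩
  · rintro ⟨_, ⟨s, hs, rfl⟩, _, ⟨t, ht, rfl⟩, rfl⟩
    exact ⟨_, ⟨s, hs, t, ht, rfl⟩, (tensorLeft_comp γ s t).symm⟩

theorem amplify_opAdj (S : Set (H →L[ℂ] K)) :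
    amplify γ α' α (opAdj S) = opAdj (amplify γ α α' S) := by
  ext X
  constructor
  · rintro ⟨⟨_, hs'⟩, ⟨s, hs, rfl⟩, rfl⟩
    have hs_mem := adjoint_mem_intertwiners hs'
    rw [ContinuousLinearMap.adjoint_adjoint] at hs_mem
    exact ⟨_, ⟨⟨s, hs_mem⟩, hs, rfl⟩, adjoint_tensorLeft γ _⟩
  · rintro ⟨_, ⟨s, hs, rfl⟩, rfl⟩
    exact ⟨_, ⟨s, hs, rfl⟩, (adjoint_tensorLeft γ s).symm⟩

theorem cspan_amplify_congr {S T : Set (H →L[ℂ] K)} (hS : S ⊆ intertwiners α α')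
    (hT : T ⊆ intertwiners α α') (h : cspan S = cspan T) :
    cspan (amplify γ α α' S) = cspan (amplify γ α α' T) :=
  cspan_image_preimage_congr (tensorLeft γ α α') hS hT h

theorem amplify_single {W : H ≃ₗᵢ[ℂ] K} (hW : Intertwines W α α') :
    amplify γ α α' (single W) = single (mapLeft W hW γ) := by
  have preimage_eq : (Subtype.val ⁻¹' single W : Set (intertwiners α α')) =
      {⟨W, hW.mem_intertwiners⟩} :=
    Set.ext fun T => (Subtype.ext_iff (a2 := ⟨_, hW.mem_intertwiners⟩)).symm
  rw [amplify, preimage_eq, Set.image_singleton, tensorLeft_coe_eq_mapLeft, single]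

theorem amplify_single_symm {W : H ≃ₗᵢ[ℂ] K} (hW : Intertwines W α α') :
    amplify γ α' α (single W.symm) = single (mapLeft W hW γ).symm := by
  rw [← opAdj_single, amplify_opAdj, amplify_single γ hW, opAdj_single]

theorem amplify_opMul_kets₂ {S : Set (H →L[ℂ] K)} (hS : S ⊆ intertwiners α α') :
    amplify γ α α' S ⬝ kets₂ α γ = kets₂ α' γ ⬝ S := by
  have tensorLeft_comp_ket₂ : ∀ (T : intertwiners α α') (η : γ.space),
      tensorLeft γ α α' T ∘L ket₂ α γ η = ket₂ α' γ η ∘L (T : H →L[ℂ] K) := fun T η =>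
    ContinuousLinearMap.ext fun v => tensorLeft_ket₂ γ T η v
  ext X
  constructor
  · rintro ⟨_, ⟨T, hT, rfl⟩, _, ⟨η, rfl⟩, rfl⟩
    exact ⟨_, ⟨η, rfl⟩, T, hT, (tensorLeft_comp_ket₂ T η).symm⟩
  · rintro ⟨_, ⟨η, rfl⟩, T, hT, rfl⟩
    exact ⟨_, ⟨⟨T, hS hT⟩, hT, rfl⟩, _, ⟨η, rfl⟩, tensorLeft_comp_ket₂ ⟨T, hS hT⟩ η⟩

theorem bras₂_opMul_amplify {S : Set (H →L[ℂ] K)} (hS : S ⊆ intertwiners α α') :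
    bras₂ α' γ ⬝ amplify γ α α' S = S ⬝ bras₂ α γ := by
  have := congrArg opAdj (amplify_opMul_kets₂ γ (opAdj_subset_intertwiners hS))
  simpa only [opAdj_opMul, amplify_opAdj, opAdj_opAdj, bras₂] using this

theorem amplify_space_opMul_opAdj :
    amplify γ α α ((α.space : Set (𝔎 →L[ℂ] H)) ⬝ opAdj α.space) = kets₁ α γ ⬝ bras₁ α γ := by
  ext X
  constructor
  · rintro ⟨⟨_, hxy⟩, ⟨x, hx, _, ⟨y, hy, rfl⟩, rfl⟩, rfl⟩
    exact ⟨_, ⟨⟨x, hx⟩, rfl⟩, _, ⟨_, ⟨⟨y, hy⟩, rfl⟩, rfl⟩,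
      ket₁_comp_adjoint_ket₁ γ ⟨x, hx⟩ ⟨y, hy⟩ hxy⟩
  · rintro ⟨_, ⟨x, rfl⟩, _, ⟨_, ⟨y, rfl⟩, rfl⟩, rfl⟩
    have hxy : (x : 𝔎 →L[ℂ] H) ∘L (y : 𝔎 →L[ℂ] H)† ∈
        (α.space : Set (𝔎 →L[ℂ] H)) ⬝ opAdj α.space :=
      ⟨x, x.2, _, ⟨y, y.2, rfl⟩, rfl⟩
    exact ⟨⟨_, α.opMul_opAdj_subset_intertwiners hxy⟩, hxy, (ket₁_comp_adjoint_ket₁ γ x y _).symm⟩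

end Amplify

section Assoc

variable (β : BaseModule B Bd H) (γ : BaseModule Bd B K) (ε : BaseModule B₂ Bd₂ K)
  (φ : BaseModule Bd₂ B₂ L) (h₁ : ActsOn γ ε) (h₂ : ActsOn ε γ)

theorem kets₁_subset_intertwiners :
    kets₁ β γ ⊆ (intertwiners ε (rtri β γ ε h₁) : Set (K →L[ℂ] RTP β γ)) := by
  rintro _ ⟨ξ, rfl⟩
  exact fun c v => (rho_rtri β γ ε h₁ c ξ v).symm

theorem kets₂_subset_intertwiners :
    kets₂ ε φ ⊆ (intertwiners γ (ltri γ ε φ h₂) : Set (K →L[ℂ] RTP ε φ)) := by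
  rintro _ ⟨η, rfl⟩
  exact fun c v => (rho_ltri γ ε φ h₂ c η v).symm

theorem ket₁_comp_mem_rtri (ξ : β.space) (η : ε.space) :
    ket₁ β γ ξ ∘L (η : 𝔎 →L[ℂ] K) ∈ (rtri β γ ε h₁).space :=
  subset_cspan _ ⟨_, ⟨ξ, rfl⟩, η, η.2, rfl⟩

theorem assoc_comp_ket₁ (ξ : β.space) (η : ε.space) :
    (assoc β γ ε φ h₁ h₂ : RTP (rtri β γ ε h₁) φ →L[ℂ] RTP β (ltri γ ε φ h₂)) ∘L
        ket₁ (rtri β γ ε h₁) φ ⟨_, ket₁_comp_mem_rtri β γ ε h₁ ξ η⟩ =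
      ket₁ β (ltri γ ε φ h₂) ξ ∘L ket₁ ε φ η :=
  φ.ext_vec fun η' hη' ζ => by
    have outer_eq := ket₁_apply_eq_ket₂_apply (rtri β γ ε h₁) φ
      ⟨_, ket₁_comp_mem_rtri β γ ε h₁ ξ η⟩ ⟨η', hη'⟩ ζ
    have inner_eq := ket₁_apply_eq_ket₂_apply ε φ η ⟨η', hη'⟩ ζ
    simp only [ContinuousLinearMap.comp_apply] at outer_eq inner_eq ⊢
    rw [outer_eq, inner_eq]
    exact assoc_apply β γ ε φ h₁ h₂ ξ _ _

theorem cspan_single_assoc_opMul_kets₁ :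
    cspan (single (assoc β γ ε φ h₁ h₂) ⬝ kets₁ (rtri β γ ε h₁) φ) =
      cspan (kets₁ β (ltri γ ε φ h₂) ⬝ kets₁ ε φ) := by
  rw [cspan_opMul_congr_right _ (cspan_kets₁_eq_of_cspan_eq (rtri β γ ε h₁) φ
    (S := kets₁ β γ ⬝ (ε.space : Set (𝔎 →L[ℂ] K))) rfl), single_opMul, Set.image_image]
  congr 1
  ext T
  constructor
  · rintro ⟨⟨_, _⟩, ⟨_, ⟨ξ, rfl⟩, η, hη, rfl⟩, rfl⟩
    exact ⟨_, ⟨ξ, rfl⟩, _, ⟨⟨η, hη⟩, rfl⟩, (assoc_comp_ket₁ β γ ε φ h₁ h₂ ξ ⟨η, hη⟩).symm⟩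
  · rintro ⟨_, ⟨ξ, rfl⟩, _, ⟨η, rfl⟩, rfl⟩
    exact ⟨⟨_, ket₁_comp_mem_rtri β γ ε h₁ ξ η⟩, ⟨_, ⟨ξ, rfl⟩, η, η.2, rfl⟩,
      assoc_comp_ket₁ β γ ε φ h₁ h₂ ξ η⟩

theorem single_assoc_opMul_amplify_kets₁ :
    single (assoc β γ ε φ h₁ h₂) ⬝ amplify φ ε (rtri β γ ε h₁) (kets₁ β γ) =
      kets₁ β (ltri γ ε φ h₂) := by
  rw [kets₁, amplify_range φ fun ξ => kets₁_subset_intertwiners β γ ε h₁ ⟨ξ, rfl⟩,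
    single_opMul_range, kets₁]
  refine congrArg Set.range (funext fun ξ => ext_ket₂ fun η v => ?_)
  rw [ContinuousLinearMap.comp_apply, tensorLeft_ket₂]
  exact assoc_apply β γ ε φ h₁ h₂ ξ v η

theorem single_assoc_symm_opMul_kets₁ :
    single (assoc β γ ε φ h₁ h₂).symm ⬝ kets₁ β (ltri γ ε φ h₂) =
      amplify φ ε (rtri β γ ε h₁) (kets₁ β γ) := by
  rw [← single_assoc_opMul_amplify_kets₁ β γ ε φ h₁ h₂, single_symm_opMul_cancel]

theorem single_assoc_opMul_kets₂ :
    single (assoc β γ ε φ h₁ h₂) ⬝ kets₂ (rtri β γ ε h₁) φ =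
      single (RTP.flip (ltri γ ε φ h₂) β) ⬝ amplify β γ (ltri γ ε φ h₂) (kets₂ ε φ) ⬝
        single (RTP.flip β γ) := by
  rw [kets₂, kets₂, amplify_range β fun η => kets₂_subset_intertwiners γ ε φ h₂ ⟨η, rfl⟩,
    single_opMul_range, range_opMul_single, single_opMul_range]
  refine congrArg Set.range (funext fun η => ext_ket₁ fun ξ v => ?_)
  let T : intertwiners γ (ltri γ ε φ h₂) := ⟨_, kets₂_subset_intertwiners γ ε φ h₂ ⟨η, rfl⟩⟩
  have flip_ket₁ : RTP.flip β γ (ket₁ β γ ξ v) = ket₂ γ β ξ v := flip_flip γ β _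
  calc assoc β γ ε φ h₁ h₂ (ket₂ (rtri β γ ε h₁) φ η (ket₁ β γ ξ v))
      = RTP.flip (ltri γ ε φ h₂) β (ket₂ (ltri γ ε φ h₂) β ξ (ket₂ ε φ η v)) :=
        assoc_apply β γ ε φ h₁ h₂ ξ v η
    _ = RTP.flip (ltri γ ε φ h₂) β (tensorLeft β _ _ T (RTP.flip β γ (ket₁ β γ ξ v))) := by
        rw [flip_ket₁, tensorLeft_ket₂]

theorem amplify_bras₂_opMul_single_flip_opMul_single_assoc :
    amplify β (ltri γ ε φ h₂) γ (bras₂ ε φ) ⬝ single (RTP.flip β (ltri γ ε φ h₂)) ⬝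
        single (assoc β γ ε φ h₁ h₂) =
      single (RTP.flip β γ) ⬝ bras₂ (rtri β γ ε h₁) φ := by
  have kets₂_eq : kets₂ (rtri β γ ε h₁) φ = single (assoc β γ ε φ h₁ h₂).symm ⬝
      single (RTP.flip (ltri γ ε φ h₂) β) ⬝ amplify β γ (ltri γ ε φ h₂) (kets₂ ε φ) ⬝
        single (RTP.flip β γ) := by
    rw [← single_assoc_opMul_kets₂, single_symm_opMul_cancel]
  rw [bras₂, bras₂, kets₂_eq]
  simp only [opAdj_opMul, opAdj_single, LinearIsometryEquiv.symm_symm, flip_symm, opMul_assoc,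
    amplify_opAdj]
  rw [← flip_symm γ β, single_symm_opMul_cancel]

end Assoc

end RTP

section PMU

open RTP

variable {βh : BaseModule Bd B H} {α : BaseModule B Bd H} {β : BaseModule Bd B H}

theorem legA_eq_cspan (W : RTP βh α ≃ₗᵢ[ℂ] RTP α β) :
    legA W = cspan (bras₁ α β ⬝ single W ⬝ kets₁ βh α) := by
  refine congrArg cspan (Set.ext fun a => ⟨?_, ?_⟩)
  · rintro ⟨ξ, η, rfl⟩
    exact ⟨_, ⟨_, ⟨ξ, rfl⟩, rfl⟩, _, ⟨_, rfl, _, ⟨η, rfl⟩, rfl⟩, rfl⟩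
  · rintro ⟨_, ⟨_, ⟨ξ, rfl⟩, rfl⟩, _, ⟨_, rfl, _, ⟨η, rfl⟩, rfl⟩, rfl⟩
    exact ⟨ξ, η, rfl⟩

theorem legAhat_eq_cspan (W : RTP βh α ≃ₗᵢ[ℂ] RTP α β) :
    legAhat W = cspan (bras₂ α β ⬝ single W ⬝ kets₂ βh α) := by
  refine congrArg cspan (Set.ext fun a => ⟨?_, ?_⟩)
  · rintro ⟨η, ξ, rfl⟩
    exact ⟨_, ⟨_, ⟨η, rfl⟩, rfl⟩, _, ⟨_, rfl, _, ⟨ξ, rfl⟩, rfl⟩, rfl⟩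
  · rintro ⟨_, ⟨_, ⟨η, rfl⟩, rfl⟩, _, ⟨_, rfl, _, ⟨ξ, rfl⟩, rfl⟩, rfl⟩
    exact ⟨η, ξ, rfl⟩

theorem BaseModule.compacts_eq_cspan (α : BaseModule B Bd H) :
    α.compacts = cspan ((α.space : Set (𝔎 →L[ℂ] H)) ⬝ opAdj α.space) := by
  refine congrArg cspan (Set.ext fun a => ⟨?_, ?_⟩)
  · rintro ⟨ξ, hξ, ξ', hξ', rfl⟩
    exact ⟨ξ, hξ, _, ⟨ξ', hξ', rfl⟩, rfl⟩
  · rintro ⟨ξ, hξ, _, ⟨ξ', hξ', rfl⟩, rfl⟩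
    exact ⟨ξ, hξ, ξ', hξ', rfl⟩

theorem IsRegular.cspan_eq {W : RTP βh α ≃ₗᵢ[ℂ] RTP α β} (h : IsRegular W) :
    cspan (bras₁ α β ⬝ single W ⬝ kets₂ βh α) =
      cspan ((α.space : Set (𝔎 →L[ℂ] H)) ⬝ opAdj α.space) := by
  rw [← α.compacts_eq_cspan, ← show _ = _ from h]
  refine congrArg cspan (Set.ext fun a => ⟨?_, ?_⟩)
  · rintro ⟨_, ⟨_, ⟨ξ, rfl⟩, rfl⟩, _, ⟨_, rfl, _, ⟨ξ', rfl⟩, rfl⟩, rfl⟩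
    exact ⟨ξ, ξ', rfl⟩
  · rintro ⟨ξ, ξ', rfl⟩
    exact ⟨_, ⟨_, ⟨ξ, rfl⟩, rfl⟩, _, ⟨_, rfl, _, ⟨ξ', rfl⟩, rfl⟩, rfl⟩

theorem IsRegular.cspan_adjoint_eq {W : RTP βh α ≃ₗᵢ[ℂ] RTP α β} (h : IsRegular W) :
    cspan (bras₂ βh α ⬝ single W.symm ⬝ kets₁ α β) =
      cspan ((α.space : Set (𝔎 →L[ℂ] H)) ⬝ opAdj α.space) := by
  simpa only [opAdj_opMul, opAdj_opAdj, opAdj_single, bras₁, bras₂,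
    opMul_assoc] using cspan_opAdj_congr h.cspan_eq

namespace IsPMU

variable {hm : IsTriModule βh α β} {W : RTP βh α ≃ₗᵢ[ℂ] RTP α β}

theorem cspan_opAdj_legA_opMul (h : IsPMU hm W) :
    cspan (opAdj (legA W : Set (H →L[ℂ] H)) ⬝ (βh.space : Set (𝔎 →L[ℂ] H))) = βh.space := by
  have single_symm_kets₁ : cspan (single W.symm ⬝ kets₁ α β ⬝ (βh.space : Set (𝔎 →L[ℂ] H))) =
      cspan (kets₁ βh α ⬝ (βh.space : Set (𝔎 →L[ℂ] H))) := by
    rw [← cspan_opMul_right]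
    exact (congrArg cspan h.map_βh_βh.single_symm_opMul).trans (cspan_cspan _)
  rw [legA_eq_cspan, cspan_opMul_congr_left (cspan_opAdj_congr (cspan_cspan _)), opAdj_opMul,
    opAdj_opMul, opAdj_single, bras₁, opAdj_opAdj, opMul_assoc, opMul_assoc,
    cspan_opMul_congr_right _ single_symm_kets₁]
  exact cspan_bras₁_kets₁_opMul hm.α_βh

theorem single_leg₁₃_opMul_kets₁ (h : IsPMU hm W) :
    single (leg₁₃ hm W h.map_βh_β) ⬝ kets₁ βh (rtri α β α hm.β_α) =
      single (RTP.flip β (ltri α βh α hm.βh_α)) ⬝ single (assoc β α βh α hm.α_βh hm.βh_α) ⬝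
        amplify α β (rtri β α βh hm.α_βh) (single (RTP.flip α β) ⬝ single W ⬝ kets₁ βh α) ⬝
          single (RTP.flip α β) := by
  have kets_sub := kets₁_subset_intertwiners βh α β hm.α_β
  have hF := flip_intertwines_ltri βh α β hm.α_βh
  simp only [leg₁₃, single_trans, opMul_assoc]
  rw [single_mapRight_opMul_kets₁, ← opMul_assoc (single (assoc βh α β α _ _).symm),
    single_assoc_symm_opMul_kets₁, ← amplify_single α h.map_βh_β, ← amplify_single α hF,
    amplify_opMul α hF.single_subset_intertwiners
      (opMul_subset_intertwiners h.map_βh_β.single_subset_intertwiners kets_sub),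
    amplify_opMul α h.map_βh_β.single_subset_intertwiners kets_sub]
  simp only [opMul_assoc]

theorem amplify_bras₂_opMul_single_leg₁₃_opMul_kets₁ (h : IsPMU hm W) :
    amplify β (ltri α βh α hm.βh_α) α (bras₂ βh α) ⬝ single (leg₁₃ hm W h.map_βh_β) ⬝
        kets₁ βh (rtri α β α hm.β_α) =
      single W ⬝ kets₁ βh α ⬝ bras₁ α β := by
  have sub : single (RTP.flip α β) ⬝ single W ⬝ kets₁ βh α ⊆
      (intertwiners β (rtri β α βh hm.α_βh) : Set (H →L[ℂ] RTP β α)) :=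
    opMul_subset_intertwiners
      (flip_intertwines_ltri βh α β hm.α_βh).single_subset_intertwiners
      (opMul_subset_intertwiners h.map_βh_β.single_subset_intertwiners
        (kets₁_subset_intertwiners βh α β hm.α_β))
  calc amplify β (ltri α βh α hm.βh_α) α (bras₂ βh α) ⬝ single (leg₁₃ hm W h.map_βh_β) ⬝
        kets₁ βh (rtri α β α hm.β_α)
      = (amplify β (ltri α βh α hm.βh_α) α (bras₂ βh α) ⬝
          single (RTP.flip β (ltri α βh α hm.βh_α)) ⬝ single (assoc β α βh α hm.α_βh hm.βh_α)) ⬝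
        amplify α β (rtri β α βh hm.α_βh) (single (RTP.flip α β) ⬝ single W ⬝ kets₁ βh α) ⬝
          single (RTP.flip α β) := by
        rw [h.single_leg₁₃_opMul_kets₁]
        simp only [opMul_assoc]
    _ = single (RTP.flip β α) ⬝ (bras₂ (rtri β α βh hm.α_βh) α ⬝
        amplify α β (rtri β α βh hm.α_βh) (single (RTP.flip α β) ⬝ single W ⬝ kets₁ βh α)) ⬝
          single (RTP.flip α β) := by
        rw [amplify_bras₂_opMul_single_flip_opMul_single_assoc]
        simp only [opMul_assoc]
    _ = (single (RTP.flip β α) ⬝ single (RTP.flip α β) ⬝ single W ⬝ kets₁ βh α) ⬝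
        bras₂ β α ⬝ single (RTP.flip α β) := by
        rw [bras₂_opMul_amplify α sub]
        simp only [opMul_assoc]
    _ = single W ⬝ kets₁ βh α ⬝ bras₁ α β := by
        rw [bras₂_opMul_single_flip, ← flip_symm α β, single_symm_opMul_cancel, opMul_assoc]

theorem amplify_bras₂_opMul_single_mapRight_opMul_kets₁ (h : IsPMU hm W) :
    amplify β (ltri α βh α hm.βh_α) α (bras₂ βh α) ⬝ single (mapLeft W h.map_α_α β).symm ⬝
        single (assoc α β α β hm.β_α hm.α_β).symm ⬝ single (mapRight α W h.map_β_α) ⬝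
          kets₁ α (ltri β βh α hm.βh_β) =
      amplify β α α (bras₂ βh α ⬝ single W.symm ⬝ kets₁ α β) ⬝ single W := by
  have kets_sub := kets₁_subset_intertwiners α β α hm.β_α
  have bras_sub := opAdj_subset_intertwiners (kets₂_subset_intertwiners α βh α hm.βh_α)
  have symm_sub := h.map_α_α.single_symm_subset_intertwiners
  rw [single_mapRight_opMul_kets₁, ← opMul_assoc (single (assoc α β α β _ _).symm),
    single_assoc_symm_opMul_kets₁, ← amplify_single_symm, bras₂,
    amplify_opMul β bras_sub (opMul_subset_intertwiners symm_sub kets_sub),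
    amplify_opMul β symm_sub kets_sub]
  simp only [opMul_assoc]

theorem single_pentagon (h : IsPMU hm W) :
    single (mapLeft W h.map_α_α β).symm ⬝ single (assoc α β α β hm.β_α hm.α_β).symm ⬝
        single (mapRight α W h.map_β_α) ⬝ single (assoc α β βh α hm.β_βh hm.βh_β) ⬝
          single (mapLeft W h.map_βh_βh α) =
      single (leg₁₃ hm W h.map_βh_β) ⬝ single (mapRight βh W h.map_α_α) ⬝
        single (assoc βh α βh α hm.α_βh hm.βh_α) := by
  simp only [← single_trans]
  refine congrArg single (LinearIsometryEquiv.ext fun x => ?_)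
  simp only [LinearIsometryEquiv.trans_apply]
  rw [h.pentagon, LinearIsometryEquiv.symm_apply_apply, LinearIsometryEquiv.symm_apply_apply]

theorem cspan_single_opMul_kets₁_opMul_bras₁ (h : IsPMU hm W) :
    cspan (single W ⬝ kets₁ βh α ⬝ bras₁ α β ⬝ single W ⬝ kets₁ βh α) =
      cspan (amplify β (ltri α βh α hm.βh_α) α (bras₂ βh α) ⬝ single (leg₁₃ hm W h.map_βh_β) ⬝
        single (mapRight βh W h.map_α_α) ⬝ single (assoc βh α βh α hm.α_βh hm.βh_α) ⬝
          kets₁ (rtri βh α βh hm.α_βh) α) := by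
  rw [cspan_opMul_congr_right _ (cspan_opMul_congr_right _ (cspan_opMul_congr_right _
    (cspan_single_assoc_opMul_kets₁ βh α βh α hm.α_βh hm.βh_α))),
    ← opMul_assoc (single (mapRight βh W h.map_α_α)), single_mapRight_opMul_kets₁]
  have := congrArg (· ⬝ single W ⬝ kets₁ βh α) h.amplify_bras₂_opMul_single_leg₁₃_opMul_kets₁
  simp only [opMul_assoc] at this ⊢
  rw [this]

theorem cspan_kets₁_opMul_bras₁ (h : IsPMU hm W) (hW : IsRegular W) :
    cspan (kets₁ α β ⬝ bras₁ α β ⬝ single W ⬝ kets₁ βh α) =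
      cspan (amplify β (ltri α βh α hm.βh_α) α (bras₂ βh α) ⬝
        single (mapLeft W h.map_α_α β).symm ⬝ single (assoc α β α β hm.β_α hm.α_β).symm ⬝
          single (mapRight α W h.map_β_α) ⬝ single (assoc α β βh α hm.β_βh hm.βh_β) ⬝
            single (mapLeft W h.map_βh_βh α) ⬝ kets₁ (rtri βh α βh hm.α_βh) α) := by
  have regular_sub : bras₂ βh α ⬝ single W.symm ⬝ kets₁ α β ⊆
      (intertwiners α α : Set (H →L[ℂ] H)) :=
    opMul_subset_intertwiners
      (opAdj_subset_intertwiners (kets₂_subset_intertwiners α βh α hm.βh_α))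
      (opMul_subset_intertwiners h.map_α_α.single_symm_subset_intertwiners
        (kets₁_subset_intertwiners α β α hm.β_α))
  have amplify_regular : cspan (amplify β α α (bras₂ βh α ⬝ single W.symm ⬝ kets₁ α β)) =
      cspan (kets₁ α β ⬝ bras₁ α β) :=
    (cspan_amplify_congr β regular_sub α.opMul_opAdj_subset_intertwiners
      hW.cspan_adjoint_eq).trans (congrArg cspan (amplify_space_opMul_opAdj β))
  rw [single_mapLeft_opMul_kets₁, cspan_opMul_congr_right _ (cspan_opMul_congr_right _
    (cspan_opMul_congr_right _ (cspan_opMul_congr_right _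
      (cspan_single_assoc_opMul_kets₁ α β βh α hm.β_βh hm.βh_β))))]
  have := congrArg (· ⬝ kets₁ βh α) h.amplify_bras₂_opMul_single_mapRight_opMul_kets₁
  simp only [opMul_assoc] at this
  rw [this, cspan_opMul_congr_left amplify_regular, opMul_assoc]

theorem cspan_kets₁_opMul_legA (h : IsPMU hm W) (hW : IsRegular W) :
    cspan (kets₁ α β ⬝ (legA W : Set (H →L[ℂ] H))) =
      cspan (single W ⬝ kets₁ βh α ⬝ (legA W : Set (H →L[ℂ] H))) := by
  have pentagon := congrArg (· ⬝ kets₁ (rtri βh α βh hm.α_βh) α) h.single_pentagon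
  simp only [opMul_assoc] at pentagon
  rw [legA_eq_cspan, cspan_opMul_right, ← opMul_assoc (single W) (kets₁ βh α),
    cspan_opMul_right, opMul_assoc, h.cspan_kets₁_opMul_bras₁ hW, pentagon,
    h.cspan_single_opMul_kets₁_opMul_bras₁]

end IsPMU

end PMU

section Kac

open RTP

variable {αh : BaseModule B Bd H} {βh : BaseModule Bd B H} {α : BaseModule B Bd H}
  {β : BaseModule Bd B H} {U : H ≃ₗᵢ[ℂ] H}

namespace IsSymmetry

theorem single_kacOp (hU : IsSymmetry αh βh α β U) (V : RTP βh α ≃ₗᵢ[ℂ] RTP α β) :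
    single (kacOp hU V) =
      single (RTP.flip α βh) ⬝ single (mapRight α U hU.β_βh) ⬝ single V := by
  rw [kacOp, single_trans, single_trans, opMul_assoc]

theorem single_checkV_opMul_kets₁ (hU : IsSymmetry αh βh α β U)
    (V : RTP βh α ≃ₗᵢ[ℂ] RTP α β) :
    single (checkV hU V) ⬝ kets₁ αh βh = single (kacOp hU V) ⬝ kets₂ βh α := by
  simp only [checkV, single_kacOp, single_trans, opMul_assoc]
  rw [single_flip_opMul_kets₁, single_mapRight_opMul_kets₂]

theorem bras₁_opMul_single_kacOp (hU : IsSymmetry αh βh α β U)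
    (V : RTP βh α ≃ₗᵢ[ℂ] RTP α β) :
    bras₁ βh α ⬝ single (kacOp hU V) = bras₂ α β ⬝ single V := by
  rw [single_kacOp, ← opMul_assoc, bras₁_opMul_single_flip, ← opMul_assoc,
    bras₂_opMul_single_mapRight]

theorem single_kacOp_symm_opMul_kets₂ (hU : IsSymmetry αh βh α β U)
    (V : RTP βh α ≃ₗᵢ[ℂ] RTP α β) :
    single (kacOp hU V).symm ⬝ kets₂ βh α =
      single V.symm ⬝ kets₁ α β ⬝ single U.symm := by
  have single_kacOp_opMul : single (kacOp hU V) ⬝ single V.symm ⬝ kets₁ α β ⬝ single U.symm =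
      kets₂ βh α := by
    have single_cancel := single_symm_opMul_cancel V.symm (kets₁ α β ⬝ single U.symm)
    rw [LinearIsometryEquiv.symm_symm] at single_cancel
    rw [single_kacOp, opMul_assoc, opMul_assoc, single_cancel,
      ← opMul_assoc (single (mapRight α U hU.β_βh)), single_mapRight_opMul_kets₁,
      opMul_assoc, opMul_single_cancel, single_flip_opMul_kets₁]
  rw [← single_kacOp_opMul, single_symm_opMul_cancel]

theorem bras₁_opMul_single (hU : IsSymmetry αh βh α β U) (V : RTP βh α ≃ₗᵢ[ℂ] RTP α β) :
    bras₁ α β ⬝ single V = single U.symm ⬝ bras₂ βh α ⬝ single (kacOp hU V) := by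
  have := congrArg opAdj (hU.single_kacOp_symm_opMul_kets₂ V)
  simp only [opAdj_opMul, opAdj_single, LinearIsometryEquiv.symm_symm, opMul_assoc] at this
  rw [bras₂, this, single_symm_opMul_cancel, bras₁]

theorem legAhat_eq_legA_checkV (hU : IsSymmetry αh βh α β U)
    (V : RTP βh α ≃ₗᵢ[ℂ] RTP α β) : legAhat V = legA (checkV hU V) := by
  rw [legAhat_eq_cspan, legA_eq_cspan, hU.single_checkV_opMul_kets₁, ← opMul_assoc,
    ← opMul_assoc, hU.bras₁_opMul_single_kacOp]

theorem bras₁_opMul_single_checkV_opMul_kets₁ (hU : IsSymmetry αh βh α β U)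
    {V : RTP βh α ≃ₗᵢ[ℂ] RTP α β}
    (cube : ∀ x, kacOp hU V (kacOp hU V (kacOp hU V x)) = x) :
    bras₁ α β ⬝ single V ⬝ single (checkV hU V) ⬝ kets₁ αh βh =
      single U.symm ⬝ (bras₂ βh α ⬝ single V.symm ⬝ kets₁ α β) ⬝ single U.symm := by
  have kacOp_sq : single (kacOp hU V) ⬝ single (kacOp hU V) = single (kacOp hU V).symm := by
    rw [← single_trans]
    exact congrArg single <| LinearIsometryEquiv.ext fun x =>
      ((LinearIsometryEquiv.symm_apply_eq _).2 (cube x).symm).symm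
  calc bras₁ α β ⬝ single V ⬝ single (checkV hU V) ⬝ kets₁ αh βh
      = single U.symm ⬝ bras₂ βh α ⬝ (single (kacOp hU V) ⬝ single (kacOp hU V)) ⬝
          kets₂ βh α := by
        rw [hU.single_checkV_opMul_kets₁, ← opMul_assoc (bras₁ α β), hU.bras₁_opMul_single]
        simp only [opMul_assoc]
    _ = single U.symm ⬝ (bras₂ βh α ⬝ single V.symm ⬝ kets₁ α β) ⬝ single U.symm := by
        rw [kacOp_sq, hU.single_kacOp_symm_opMul_kets₂]
        simp only [opMul_assoc]

theorem cspan_bras₁_opMul_single_checkV_opMul_kets₁ (hU : IsSymmetry αh βh α β U)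
    {V : RTP βh α ≃ₗᵢ[ℂ] RTP α β} (hV : IsRegular V)
    (cube : ∀ x, kacOp hU V (kacOp hU V (kacOp hU V x)) = x) :
    cspan (bras₁ α β ⬝ single V ⬝ single (checkV hU V) ⬝ kets₁ αh βh) =
      cspan ((αh.space : Set (𝔎 →L[ℂ] H)) ⬝ opAdj αh.space) := by
  rw [hU.bras₁_opMul_single_checkV_opMul_kets₁ cube,
    cspan_opMul_congr_right _ (cspan_opMul_congr_left hV.cspan_adjoint_eq _), opMul_assoc,
    ← opAdj_single, ← opAdj_opMul, hU.α_αh.single_opMul, ← opMul_assoc, opAdj_single,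
    hU.αh_α.single_symm_opMul]

theorem cspan_legA_opMul_legAhat (hm : IsTriModule αh βh α) (hU : IsSymmetry αh βh α β U)
    {V : RTP βh α ≃ₗᵢ[ℂ] RTP α β} (pmu_check : IsPMU hm (checkV hU V)) (regular : IsRegular V)
    (regular_check : IsRegular (checkV hU V))
    (cube : ∀ x, kacOp hU V (kacOp hU V (kacOp hU V x)) = x) :
    cspan ((legA V : Set (H →L[ℂ] H)) ⬝ (legAhat V : Set (H →L[ℂ] H))) = αh.compacts := by
  have adjoint_space_opMul_legA : cspan (opAdj αh.space ⬝ (legA (checkV hU V) : Set (H →L[ℂ] H))) =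
      cspan (opAdj (αh.space : Set (𝔎 →L[ℂ] H))) := by
    simpa only [opAdj_opMul, opAdj_opAdj] using cspan_opAdj_congr
      (pmu_check.cspan_opAdj_legA_opMul.trans (cspan_coe αh.isClosed).symm)
  rw [hU.legAhat_eq_legA_checkV, αh.compacts_eq_cspan]
  set Ahat : Set (H →L[ℂ] H) := ↑(legA (checkV hU V))
  calc cspan ((legA V : Set (H →L[ℂ] H)) ⬝ Ahat)
      = cspan (bras₁ α β ⬝ single V ⬝ kets₁ βh α ⬝ Ahat) := by
        rw [legA_eq_cspan, cspan_opMul_left]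
        simp only [opMul_assoc]
    _ = cspan (bras₁ α β ⬝ single V ⬝ single (checkV hU V) ⬝ kets₁ αh βh ⬝ Ahat) :=
        cspan_opMul_congr_right _ <| cspan_opMul_congr_right _ <|
          pmu_check.cspan_kets₁_opMul_legA regular_check
    _ = cspan ((bras₁ α β ⬝ single V ⬝ single (checkV hU V) ⬝ kets₁ αh βh) ⬝ Ahat) := by
        simp only [opMul_assoc]
    _ = cspan ((αh.space : Set (𝔎 →L[ℂ] H)) ⬝ opAdj αh.space ⬝ Ahat) := by
        rw [cspan_opMul_congr_left
          (hU.cspan_bras₁_opMul_single_checkV_opMul_kets₁ regular cube), opMul_assoc]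
    _ = cspan ((αh.space : Set (𝔎 →L[ℂ] H)) ⬝ opAdj αh.space) :=
        cspan_opMul_congr_right _ adjoint_space_opMul_legA

end IsSymmetry

end Kac

end Modules

end PseudoKac

end

theorem mainTheorem12_general {𝔎 H : Type*}
    [NormedAddCommGroup 𝔎] [InnerProductSpace ℂ 𝔎] [CompleteSpace 𝔎]
    [NormedAddCommGroup H] [InnerProductSpace ℂ H] [CompleteSpace H]
    {B Bd : NonUnitalStarSubalgebra ℂ (𝔎 →L[ℂ] 𝔎)}
    (αh : PseudoKac.BaseModule B Bd H) (βh : PseudoKac.BaseModule Bd B H)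
    (α : PseudoKac.BaseModule B Bd H) (β : PseudoKac.BaseModule Bd B H)
    (hm : PseudoKac.IsTriModule αh βh α)
    (V : PseudoKac.RTP βh α ≃ₗᵢ[ℂ] PseudoKac.RTP α β) (U : H ≃ₗᵢ[ℂ] H)
    (hU : PseudoKac.IsSymmetry αh βh α β U)
    (pmu_check : PseudoKac.IsPMU hm (PseudoKac.checkV hU V))
    (regular : PseudoKac.IsRegular V)
    (regular_check : PseudoKac.IsRegular (PseudoKac.checkV hU V))
    (cube : ∀ x, PseudoKac.kacOp hU V (PseudoKac.kacOp hU V (PseudoKac.kacOp hU V x)) = x) :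
    PseudoKac.cspan {x : H →L[ℂ] H |
        ∃ a ∈ PseudoKac.legA V, ∃ a' ∈ PseudoKac.legAhat V, a ∘L a' = x} =
      PseudoKac.cspan {x : H →L[ℂ] H |
        ∃ ξ ∈ αh.space, ∃ ξ' ∈ αh.space, ξ ∘L ContinuousLinearMap.adjoint ξ' = x} :=
  hU.cspan_legA_opMul_legAhat hm pmu_check regular regular_check cube

theorem mainTheorem12 {𝔎 H : Type*}
    [NormedAddCommGroup 𝔎] [InnerProductSpace ℂ 𝔎] [CompleteSpace 𝔎]
    [NormedAddCommGroup H] [InnerProductSpace ℂ H] [CompleteSpace H]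
    {B Bd : NonUnitalStarSubalgebra ℂ (𝔎 →L[ℂ] 𝔎)}
    (αh : PseudoKac.BaseModule B Bd H) (βh : PseudoKac.BaseModule Bd B H)
    (α : PseudoKac.BaseModule B Bd H) (β : PseudoKac.BaseModule Bd B H)
    (hm : PseudoKac.IsQuadModule αh βh α β)
    (V : PseudoKac.RTP βh α ≃ₗᵢ[ℂ] PseudoKac.RTP α β) (U : H ≃ₗᵢ[ℂ] H)
    (hVU : PseudoKac.IsPseudoKacSystem hm V U) :
    PseudoKac.cspan {x : H →L[ℂ] H |
        ∃ a ∈ PseudoKac.legA V, ∃ a' ∈ PseudoKac.legAhat V, a ∘L a' = x} =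
      PseudoKac.cspan {x : H →L[ℂ] H |
        ∃ ξ ∈ αh.space, ∃ ξ' ∈ αh.space, ξ ∘L ContinuousLinearMap.adjoint ξ' = x} :=
  mainTheorem12_general αh βh α β hm.triCheck V U hVU.symmetry hVU.pmu_check hVU.regular
    hVU.regular_check hVU.cube
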